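/- Let $d\ge 1$ be fixed and let $(\mathbf X_i,Y_i)_{i\ge 1}$ be i.i.d. observations in $\mathbb R^d\times\mathbb R$ from the model $Y_i=\mu(\mathbf X_i)+\epsilon_i$, where the noise $\epsilon_i$ is independent of $\mathbf X_i$ and has mean zero and finite variance $\sigma_\epsilon^2>0$, and $\mathbb E\,Y_i^2<\infty$. Assume that $\mathbf X_i$ has a density $f$ with respect to Lebesgue measure on $\mathbb R^d$ that is bounded away from $0$ and $\infty$ (almost everywhere with respect to the law of $\mathbf X_i$). Let $\mathbf x\in\mathrm{supp}(\mathbf X)$ and assume that $f$ and $\mu$ are twice continuously differentiable with bounded second derivatives in a neighborhood of $\mathbf x$. For $1\le s\le n$ and labels $1\le i_1<\dots<i_s\le n$ let $\Phi(\mathbf x;\mathbf Z_{i_1},\dots,\mathbf Z_{i_s})$, with $\mathbf Z_i=(\mathbf X_i,Y_i)$, be the response of that observation among $\mathbf Z_{i_1},\dots,\mathbf Z_{i_s}$ whose feature vector is closest to $\mathbf x$ in Euclidean distance (ties are broken in favour of the smaller label), and let the distributional nearest neighbors (DNN) estimator be $$D_n(s)(\mathbf x)=\binom ns^{-1}\sum_{1\le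 i_1<\dots<i_s\le n}\Phi(\mathbf x;\mathbf Z_{i_1},\dots,\mathbf Z_{i_s}).$$ Then there is a bias function $B:\mathbb N\to\mathbb R$, not depending on $n$, such that $D_n(s)(\mathbf x)$ is integrable with $\mathbb E\,D_n(s)(\mathbf x)=\mu(\mathbf x)+B(s)$ for all $1\le s\le n$, and, as $s\to\infty$, $$B(s)=\Gamma(2/d+1)\,\frac{f(\mathbf x)\,\mathrm{tr}(\mu''(\mathbf x))+2\,\mu'(\mathbf x)^Tf'(\mathbf x)}{2\,d\,V_d^{2/d}\,f(\mathbf x)^{1+2/d}}\,s^{-2/d}+o(s^{-2/d}),\qquad V_d=\frac{\pi^{d/2}}{\Gamma(1+d/2)}.$$ Moreover, for every sequence $s=s_n$ of natural numbers with $s_n\to\infty$ and $s_n/n\to 0$ there are (deterministic) $\sigma_n>0$ with $\sigma_n^2=O(s_n/n)$ such that, as $n\to\infty$, $$\frac{D_n(s_n)(\mathbf x)-\mu(\mathbf x)-B(s_n)}{\sigma_n}\ \overset{\mathscr D}{\longrightarrow}\ N(0,1).$$ -/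

import Mathlib

open MeasureTheory ProbabilityTheory Filter Topology Asymptotics

/-- Within the subsample of the observations `z j = (x_j, y_j)` with labels `j ∈ S`, the label `i`
is the one of the 1-nearest neighbour of `x` (Euclidean distance of the features to `x`; ties are
broken in favour of the smaller label). -/
def IsNearest {d : ℕ} (x : EuclideanSpace ℝ (Fin d)) (z : ℕ → EuclideanSpace ℝ (Fin d) × ℝ)
    (S : Finset ℕ) (i : ℕ) : Prop :=
  i ∈ S ∧ ∀ j ∈ S, dist (z i).1 x < dist (z j).1 x ∨ (dist (z i).1 x = dist (z j).1 x ∧ i ≤ j)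

/-- A non-empty subsample has exactly one 1-nearest neighbour of `x`. -/
theorem existsUnique_isNearest {d : ℕ} (x : EuclideanSpace ℝ (Fin d))
    (z : ℕ → EuclideanSpace ℝ (Fin d) × ℝ) (S : Finset ℕ) (hS : S.Nonempty) :
    ∃! i, IsNearest x z S i := by
  obtain ⟨i, hi, hmin⟩ := S.exists_min_image (fun j => toLex (dist (z j).1 x, j)) hS
  refine ⟨i, ⟨hi, fun j hj => by simpa [Prod.Lex.toLex_le_toLex] using hmin j hj⟩, ?_⟩
  rintro k ⟨hk, hk'⟩
  have h1 := hk' i hi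
  have h2 := hmin k hk
  simp only [Prod.Lex.toLex_le_toLex] at h2
  rcases h1 with h1 | ⟨h1, h1'⟩ <;> rcases h2 with h2 | ⟨h2, h2'⟩
  · exact absurd h2 (lt_asymm h1)
  · exact absurd h2 (ne_of_gt h1)
  · exact absurd h1 (ne_of_gt h2)
  · exact le_antisymm h1' h2'

open Classical in
/-- The 1-nearest neighbour estimator `Φ(x; z_{i₁}, …, z_{iₛ})` of the subsample with labels
`S = {i₁ < ⋯ < iₛ}`: the response of the 1-nearest neighbour of `x` (for `S ≠ ∅` exactly one summand
satisfies the condition). -/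
noncomputable def nnEstimator {d : ℕ} (x : EuclideanSpace ℝ (Fin d))
    (z : ℕ → EuclideanSpace ℝ (Fin d) × ℝ) (S : Finset ℕ) : ℝ :=
  ∑ i ∈ S, if IsNearest x z S i then (z i).2 else 0

/-- The distributional nearest neighbours estimator `D_n(s)(x)` with subsampling scale `s`, computed
from the first `n` observations `z 0, …, z (n - 1)`: the average of the 1-nearest neighbour
estimators over all subsamples of size `s`. -/
noncomputable def dnn {d : ℕ} (x : EuclideanSpace ℝ (Fin d))
    (z : ℕ → EuclideanSpace ℝ (Fin d) × ℝ) (n s : ℕ) : ℝ :=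
  (n.choose s : ℝ)⁻¹ * ∑ S ∈ (Finset.range n).powersetCard s, nnEstimator x z S

/-- `V_d = π^{d/2} / Γ(1 + d/2)`, the volume of the Euclidean unit ball of `ℝᵈ`. -/
noncomputable def unitBallVolume (d : ℕ) : ℝ :=
  Real.pi ^ ((d : ℝ) / 2) / Real.Gamma (1 + (d : ℝ) / 2)

/-- The coefficient
`Γ(2/d + 1) (f(x) tr(μ''(x)) + 2 μ'(x)ᵀ f'(x)) / (2 d V_d^{2/d} f(x)^{1 + 2/d})`
of the leading bias term; the Laplacian of `μ` at `x` is the trace of the Hessian of `μ` at `x`. -/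
noncomputable def biasCoeff {d : ℕ} (f μ : EuclideanSpace ℝ (Fin d) → ℝ)
    (x : EuclideanSpace ℝ (Fin d)) : ℝ :=
  Real.Gamma (2 / (d : ℝ) + 1) *
    ((f x * Laplacian.laplacian μ x + 2 * inner ℝ (gradient μ x) (gradient f x)) /
      (2 * (d : ℝ) * unitBallVolume d ^ (2 / (d : ℝ)) * f x ^ (1 + 2 / (d : ℝ))))

/-!
# Asymptotic normality of the distributional nearest neighbours estimator

Let `ν` be the law of the features and `tailProb ν x z` the `ν`-probability of being farther from
`x` than `z`. Spheres are `ν`-null, so `1 - tailProb ν x` is uniform on `(0, 1]` under `ν`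
(`integral_comp_one_sub_tailProb`), and the nearest neighbour among `s` features has the density
`s * tailProb ν x ^ (s - 1)` with respect to `ν` (`integral_mul_nnInd`). Everything about nearest
neighbours is thereby reduced to integrals against powers of `tailProb ν x`.

*Bias.* The expectation of the estimator is `m s = s * ∫ μ * tailProb ν x ^ (s - 1) ∂ν`, whatever
the sample size. Only the behaviour of `μ` near `x` matters for large `s`
(`isLittleO_integral_mul_tailProb_pow`). The second order expansion of `(μ - μ x) * f` at `x`
consists of a linear form and a quadratic form; `tailProb ν x` being radial, the linear form
integrates to zero and the quadratic form may be replaced by the multiple of `‖h‖ ^ 2` with the same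
trace (`integral_linear_add_quadratic_mul_radial`). That trace is
`(f x * Δ μ x + 2 ⟪∇ μ x, ∇ f x⟫) / 2`. Finally `dist z x ^ 2` is
`((1 - tailProb ν x z) / (V_d * f x)) ^ (2 / d)` up to lower order (`dist_sq_sub_isLittleO`), and
`s * E [U ^ a * (1 - U) ^ (s - 1)] ~ Γ (a + 1) * s ^ (-a)` for a uniform `U`. Together this is
`bias_sub_isLittleO`.

*Fluctuations.* The estimator is `∑ w i * Y i`, where the weight `w i` is the proportion of the
subsamples of size `s` in which `i` is the nearest neighbour. Centred at its mean, it is the sum of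

* `T = s / n * ∑ tailProb ν x (X i) ^ (s - 1) * ε i`,
* `A = ∑ (w i - s / n * tailProb ν x (X i) ^ (s - 1)) * ε i`,
* `C = ∑ w i * μ (X i) - m s`.

The variance of `T` is of order `s / n` (`projectionSD`), and `T` is a sum of independent terms whose
weights are bounded by `o(√n)` times their root mean square, so that an expansion of the
characteristic function gives its asymptotic normality (`tendstoInDistribution_weighted_sum`). The
other two terms are negligible. In `A`, the weight is compared with its conditional expectation
given `X i`; two subsamples that share only `i` contribute nothing to the mean square, which gains a
factor `s / n` (`integral_sq_nnWeight_sub_le`). The term `C` is a `U`-statistic of order `s`, so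
Hoeffding's averaging over disjoint blocks bounds its variance by `2 * s / n` times the mean of
`(μ - μ x) ^ 2` at the nearest neighbour (`integral_sq_dnn_sub_le`), which tends to zero by
continuity of `μ`. The conclusion follows from Slutsky's theorem.
-/

/-! ### The probability integral transform -/

/-- The distribution function of a probability measure without atoms, evaluated at a point drawn
from that measure, is uniform on `(0, 1]`. -/
theorem map_cdf_eq_restrict_volume (ρ : Measure ℝ) [IsProbabilityMeasure ρ]
    [NullSingletonClass ρ] :
    ρ.map (cdf ρ) = volume.restrict (Set.Ioc 0 1) := by
  have hmeas : Measurable (cdf ρ) := (monotone_cdf ρ).measurable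
  have hcont : Continuous (cdf ρ) := by
    rw [continuous_iff_continuousAt]
    intro t
    have h := (cdf ρ).measure_singleton t
    rw [measure_cdf, measure_singleton, eq_comm, ENNReal.ofReal_eq_zero] at h
    have hle := (cdf ρ).mono.leftLim_le (le_refl t)
    exact (cdf ρ).mono.continuousAt_iff_leftLim_eq_rightLim.2
      (by rw [StieltjesFunction.rightLim_eq]; linarith)
  have hex : ∀ v ∈ Set.Ioo (0 : ℝ) 1, ∃ t, cdf ρ t = v := fun v hv =>
    mem_range_of_exists_le_of_exists_ge hcont
      (((tendsto_cdf_atBot ρ).eventually (eventually_le_nhds hv.1)).exists)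
      (((tendsto_cdf_atTop ρ).eventually (eventually_ge_nhds hv.2)).exists)
  have hup : ∀ u, ∀ v ∈ Set.Ioo (0 : ℝ) 1, u < v → ρ (cdf ρ ⁻¹' Set.Iic u) ≤ ENNReal.ofReal v := by
    intro u v hv huv
    obtain ⟨t, rfl⟩ := hex v hv
    rw [ofReal_cdf]
    refine measure_mono fun r hr => ?_
    by_contra hlt
    exact absurd ((monotone_cdf ρ) (le_of_not_ge hlt)) (not_le.2 (lt_of_le_of_lt hr huv))
  have : IsFiniteMeasure (ρ.map (cdf ρ)) := by infer_instance
  refine Measure.ext_of_Iic _ _ fun u => ?_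
  rw [Measure.map_apply hmeas measurableSet_Iic, Measure.restrict_apply measurableSet_Iic]
  have hset : Set.Iic u ∩ Set.Ioc (0 : ℝ) 1 = Set.Ioc 0 (min u 1) := by
    ext r; simp only [Set.mem_inter_iff, Set.mem_Iic, Set.mem_Ioc, le_min_iff]; tauto
  rw [hset, Real.volume_Ioc, sub_zero]
  rcases le_or_gt 1 u with hu | hu
  · rw [min_eq_right hu, ENNReal.ofReal_one]
    have : cdf ρ ⁻¹' Set.Iic u = Set.univ :=
      Set.eq_univ_of_forall fun r => (cdf_le_one ρ r).trans hu
    rw [this, measure_univ]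
  · rw [min_eq_left hu.le]
    apply le_antisymm
    · have hlim : Tendsto (fun v : ℝ => ENNReal.ofReal v) (𝓝[>] (max u 0))
          (𝓝 (ENNReal.ofReal (max u 0))) :=
        (ENNReal.continuous_ofReal.tendsto _).mono_left nhdsWithin_le_nhds
      have h1 : ENNReal.ofReal (max u 0) = ENNReal.ofReal u := by simp [ENNReal.ofReal_max]
      rw [← h1]
      refine ge_of_tendsto hlim ?_
      filter_upwards [Ioo_mem_nhdsGT (show max u 0 < 1 by simp [hu])] with v hv
      exact hup u v ⟨lt_of_le_of_lt (le_max_right _ _) hv.1, hv.2⟩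
        (lt_of_le_of_lt (le_max_left _ _) hv.1)
    · rcases le_or_gt u 0 with h0 | h0
      · simp [ENNReal.ofReal_of_nonpos h0]
      · obtain ⟨t, rfl⟩ := hex u ⟨h0, hu⟩
        rw [ofReal_cdf]
        exact measure_mono fun r hr => (monotone_cdf ρ) hr

/-! ### The probability of being farther from the target -/

section tailProb

variable {E : Type*} [PseudoMetricSpace E] [MeasurableSpace E]

/-- The `ν`-probability of being strictly farther from `x` than `z` is. -/
noncomputable def tailProb (ν : Measure E) (x z : E) : ℝ := ν.real {w | dist z x < dist w x}

theorem tailProb_nonneg (ν : Measure E) (x z : E) : 0 ≤ tailProb ν x z := measureReal_nonneg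

theorem tailProb_le_one (ν : Measure E) [IsProbabilityMeasure ν] (x z : E) : tailProb ν x z ≤ 1 :=
  measureReal_le_one

variable [OpensMeasurableSpace E] (ν : Measure E) [IsProbabilityMeasure ν] (x : E)

theorem one_sub_tailProb (z : E) : 1 - tailProb ν x z = ν.real {w | dist w x ≤ dist z x} := by
  have hm : MeasurableSet {w | dist w x ≤ dist z x} :=
    measurableSet_le (by fun_prop) (by fun_prop)
  have h := probReal_compl_eq_one_sub (μ := ν) hm
  rw [tailProb, show {w | dist z x < dist w x} = {w | dist w x ≤ dist z x}ᶜ by ext; simp, h]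
  ring

theorem one_sub_tailProb_eq_cdf (z : E) :
    1 - tailProb ν x z = cdf (ν.map fun w => dist w x) (dist z x) := by
  have : IsProbabilityMeasure (ν.map fun w => dist w x) :=
    Measure.isProbabilityMeasure_map (by fun_prop)
  rw [one_sub_tailProb, cdf_eq_real, map_measureReal_apply (by fun_prop) measurableSet_Iic]
  rfl

theorem measurable_tailProb : Measurable (tailProb ν x) := by
  have h : tailProb ν x = fun z => 1 - cdf (ν.map fun w => dist w x) (dist z x) := by
    ext z; rw [← one_sub_tailProb_eq_cdf]; ring
  rw [h]
  exact measurable_const.sub ((monotone_cdf _).measurable.comp (by fun_prop))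

variable {ν x}

theorem map_one_sub_tailProb (hν : ∀ r, ν {w | dist w x = r} = 0) :
    ν.map (fun z => 1 - tailProb ν x z) = volume.restrict (Set.Ioc 0 1) := by
  have hd : Measurable fun w : E => dist w x := by fun_prop
  have : IsProbabilityMeasure (ν.map fun w => dist w x) :=
    Measure.isProbabilityMeasure_map hd.aemeasurable
  have : NullSingletonClass (ν.map fun w => dist w x) :=
    ⟨fun r => by rw [Measure.map_apply hd (measurableSet_singleton r)]; exact hν r⟩
  simp_rw [one_sub_tailProb_eq_cdf]
  rw [← map_cdf_eq_restrict_volume (ν.map fun w => dist w x),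
    Measure.map_map (monotone_cdf _).measurable hd]
  rfl

/-- Under `ν` the quantity `1 - tailProb ν x` is uniform. -/
theorem integral_comp_one_sub_tailProb (hν : ∀ r, ν {w | dist w x = r} = 0) {φ : ℝ → ℝ}
    (hφ : Measurable φ) :
    ∫ z, φ (1 - tailProb ν x z) ∂ν = ∫ u in (0 : ℝ)..1, φ u := by
  rw [intervalIntegral.integral_of_le zero_le_one, ← map_one_sub_tailProb hν,
    integral_map (by have := measurable_tailProb ν x; fun_prop) hφ.aestronglyMeasurable]

theorem integrable_tailProb_pow (m : ℕ) : Integrable (fun z => tailProb ν x z ^ m) ν := by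
  refine Integrable.of_bound (C := 1) ((measurable_tailProb ν x).pow_const m).aestronglyMeasurable
    (ae_of_all _ fun z => ?_)
  rw [Real.norm_of_nonneg (pow_nonneg (tailProb_nonneg ν x z) m)]
  exact pow_le_one₀ (tailProb_nonneg ν x z) (tailProb_le_one ν x z)

theorem integral_tailProb_pow (hν : ∀ r, ν {w | dist w x = r} = 0) (m : ℕ) :
    ∫ z, tailProb ν x z ^ m ∂ν = 1 / ((m : ℝ) + 1) := by
  have h := integral_comp_one_sub_tailProb hν (φ := fun u => (1 - u) ^ m) (by fun_prop)
  simp only [sub_sub_cancel] at h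
  rw [h, intervalIntegral.integral_comp_sub_left (fun u => u ^ m) 1]
  simp

/-- The beta integral `∫ U ^ a (1 - U) ^ m` for the uniform variable `U = 1 - tailProb ν x`, in the
form that makes its asymptotics those of Euler's sequence for the Gamma function. -/
theorem integral_rpow_mul_tailProb_pow (hν : ∀ r, ν {w | dist w x = r} = 0) {a : ℝ} (ha : 0 < a)
    (m : ℕ) :
    ((m + 1 : ℕ) : ℝ) * ∫ z, (1 - tailProb ν x z) ^ a * tailProb ν x z ^ m ∂ν =
      a * ((m + 1 : ℕ) : ℝ) ^ (-a) * Real.GammaSeq a (m + 1) := by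
  have h := integral_comp_one_sub_tailProb hν (φ := fun u => u ^ a * (1 - u) ^ m) (by fun_prop)
  simp only [sub_sub_cancel] at h
  have hb := Complex.betaIntegral_eval_nat_add_one_right (u := ((a + 1 : ℝ) : ℂ))
    (by simp; linarith) m
  rw [Complex.betaIntegral] at hb
  have hc : ((∫ u in (0 : ℝ)..1, u ^ a * (1 - u) ^ m : ℝ) : ℂ) =
      (m.factorial : ℂ) / ∏ j ∈ Finset.range (m + 1), (((a + 1 : ℝ) : ℂ) + j) := by
    rw [← hb, ← intervalIntegral.integral_ofReal]
    refine intervalIntegral.integral_congr fun u hu => ?_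
    rw [Set.uIcc_of_le zero_le_one] at hu
    simp [Complex.ofReal_cpow hu.1]
  have hr : ∫ u in (0 : ℝ)..1, u ^ a * (1 - u) ^ m =
      (m.factorial : ℝ) / ∏ j ∈ Finset.range (m + 1), (a + 1 + j) := by
    exact_mod_cast hc
  rw [h, hr, Real.GammaSeq, Finset.prod_range_succ' _ (m + 1)]
  have hpos : (0 : ℝ) < ∏ j ∈ Finset.range (m + 1), (a + 1 + j) :=
    Finset.prod_pos fun j _ => by positivity
  have hpr : ∏ j ∈ Finset.range (m + 1), (a + ((j + 1 : ℕ) : ℝ)) =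
      ∏ j ∈ Finset.range (m + 1), (a + 1 + j) :=
    Finset.prod_congr rfl fun j _ => by push_cast; ring
  have hs : (0 : ℝ) < ((m + 1 : ℕ) : ℝ) := by positivity
  rw [hpr, Real.rpow_neg hs.le, Nat.factorial_succ, Nat.cast_zero, add_zero, Nat.cast_mul]
  have := (Real.rpow_pos_of_pos hs a).ne'
  field_simp

/-! ### Concentration at the target -/

theorem integrable_mul_tailProb_pow {φ : E → ℝ} (hφ : Integrable φ ν) (m : ℕ) :
    Integrable (fun z => φ z * tailProb ν x z ^ m) ν := by
  refine hφ.mul_bdd (c := 1) ((measurable_tailProb ν x).pow_const m).aestronglyMeasurable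
    (ae_of_all _ fun z => ?_)
  rw [Real.norm_of_nonneg (pow_nonneg (tailProb_nonneg ν x z) m)]
  exact pow_le_one₀ (tailProb_nonneg ν x z) (tailProb_le_one ν x z)

theorem integrable_one_sub_tailProb_rpow {a : ℝ} (ha : 0 ≤ a) :
    Integrable (fun z => (1 - tailProb ν x z) ^ a) ν := by
  refine Integrable.of_bound (C := 1)
    (((measurable_tailProb ν x).const_sub 1).pow_const a).aestronglyMeasurable
    (ae_of_all _ fun z => ?_)
  have h0 : 0 ≤ 1 - tailProb ν x z := sub_nonneg.2 (tailProb_le_one ν x z)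
  rw [Real.norm_of_nonneg (Real.rpow_nonneg h0 a)]
  exact Real.rpow_le_one h0 (by linarith [tailProb_nonneg ν x z]) ha

/-- The constant `a * Γ(a)`, which is `Γ(a + 1)`, is the limit of `s ^ (a + 1) * B(a + 1, s)`. -/
theorem tendsto_integral_rpow_mul_tailProb_pow (hν : ∀ r, ν {w | dist w x = r} = 0) {a : ℝ}
    (ha : 0 ≤ a) :
    Tendsto (fun s : ℕ => (s : ℝ) ^ a *
      ((s : ℝ) * ∫ z, (1 - tailProb ν x z) ^ a * tailProb ν x z ^ (s - 1) ∂ν)) atTop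
      (𝓝 (Real.Gamma (a + 1))) := by
  rcases ha.eq_or_lt with rfl | ha
  · refine tendsto_const_nhds.congr' ?_
    filter_upwards [eventually_ge_atTop 1] with s hs
    obtain ⟨m, rfl⟩ := Nat.exists_eq_add_of_le' hs
    simp only [Real.rpow_zero, one_mul, Nat.add_sub_cancel, zero_add, Real.Gamma_one]
    rw [integral_tailProb_pow hν]
    push_cast
    field_simp
  · have h := (Real.GammaSeq_tendsto_Gamma a).const_mul a
    rw [← Real.Gamma_add_one ha.ne'] at h
    refine h.congr' ?_
    filter_upwards [eventually_ge_atTop 1] with s hs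
    obtain ⟨m, rfl⟩ := Nat.exists_eq_add_of_le' hs
    rw [Nat.add_sub_cancel, integral_rpow_mul_tailProb_pow hν ha]
    have hpos : (0 : ℝ) < ((m + 1 : ℕ) : ℝ) := by positivity
    have := (Real.rpow_pos_of_pos hpos a).ne'
    rw [Real.rpow_neg hpos.le]
    field_simp

/-- Only the values near `x` matter for the expectation of `φ` at the nearest neighbour: an
integrable `φ` that is `o(U ^ a)` at `x`, with `U = 1 - tailProb ν x`, contributes `o(s ^ (-a))`. -/
theorem isLittleO_integral_mul_tailProb_pow [BorelSpace E] (hν : ∀ r, ν {w | dist w x = r} = 0)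
    (hx : x ∈ ν.support) {a : ℝ} (ha : 0 ≤ a) {φ : E → ℝ} (hφ : Integrable φ ν)
    (hlo : φ =o[𝓝 x] fun z => (1 - tailProb ν x z) ^ a) :
    (fun s : ℕ => (s : ℝ) * ∫ z, φ z * tailProb ν x z ^ (s - 1) ∂ν)
      =o[atTop] fun s : ℕ => (s : ℝ) ^ (-a) := by
  have hG : 0 < Real.Gamma (a + 1) := Real.Gamma_pos_of_pos (by linarith)
  rw [isLittleO_iff]
  intro c hc
  set δ : ℝ := c / (4 * Real.Gamma (a + 1)) with hδ
  have hδ0 : 0 < δ := by positivity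
  obtain ⟨r, hr, hball⟩ := Metric.eventually_nhds_iff_ball.1 ((isLittleO_iff.1 hlo) hδ0)
  -- outside the ball, `tailProb` is at most `q < 1`
  set q : ℝ := 1 - ν.real (Metric.ball x r) with hq
  have hpos : 0 < ν.real (Metric.ball x r) :=
    ENNReal.toReal_pos ((Measure.mem_support_iff_forall x).1 hx _ (Metric.ball_mem_nhds x hr)).ne'
      (measure_ne_top _ _)
  have hq1 : q < 1 := by linarith
  have hq0 : 0 ≤ q := sub_nonneg.2 measureReal_le_one
  have hout : ∀ z, z ∉ Metric.ball x r → tailProb ν x z ≤ q := by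
    intro z hz
    have h1 : ν.real (Metric.ball x r) ≤ 1 - tailProb ν x z := by
      rw [one_sub_tailProb]
      refine measureReal_mono (fun w hw => ?_)
      rw [Metric.mem_ball] at hw hz
      exact (hw.trans_le (not_lt.1 hz)).le
    linarith
  have hbound : ∀ m : ℕ, |∫ z, φ z * tailProb ν x z ^ m ∂ν| ≤
      δ * (∫ z, (1 - tailProb ν x z) ^ a * tailProb ν x z ^ m ∂ν) + q ^ m * ∫ z, |φ z| ∂ν := by
    intro m
    rw [← integral_const_mul, ← integral_const_mul, ← integral_add]
    · refine (abs_integral_le_integral_abs).trans (integral_mono_of_nonneg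
        (ae_of_all _ fun _ => abs_nonneg _) ?_ (ae_of_all _ fun z => ?_))
      · exact ((integrable_mul_tailProb_pow (integrable_one_sub_tailProb_rpow ha) m).const_mul
          δ).add (hφ.abs.const_mul _)
      · have ht := tailProb_nonneg ν x z
        have hU : 0 ≤ (1 - tailProb ν x z) ^ a :=
          Real.rpow_nonneg (sub_nonneg.2 (tailProb_le_one ν x z)) a
        simp only [abs_mul, abs_pow, abs_of_nonneg ht]
        by_cases hz : z ∈ Metric.ball x r
        · have h := hball z hz
          rw [Real.norm_of_nonneg hU, Real.norm_eq_abs] at h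
          have : |φ z| * tailProb ν x z ^ m ≤
              δ * ((1 - tailProb ν x z) ^ a * tailProb ν x z ^ m) := by
            rw [← mul_assoc]; gcongr
          have h2 : 0 ≤ q ^ m * |φ z| := by positivity
          linarith
        · have : |φ z| * tailProb ν x z ^ m ≤ q ^ m * |φ z| := by
            rw [mul_comm]; gcongr; exact hout z hz
          have h2 : 0 ≤ δ * ((1 - tailProb ν x z) ^ a * tailProb ν x z ^ m) := by positivity
          linarith
    · exact (integrable_mul_tailProb_pow (integrable_one_sub_tailProb_rpow ha) m).const_mul δ
    · exact hφ.abs.const_mul _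
  have hlim1 : Tendsto (fun s : ℕ => δ * ((s : ℝ) ^ a *
      ((s : ℝ) * ∫ z, (1 - tailProb ν x z) ^ a * tailProb ν x z ^ (s - 1) ∂ν))) atTop
      (𝓝 (δ * Real.Gamma (a + 1))) :=
    (tendsto_integral_rpow_mul_tailProb_pow hν ha).const_mul δ
  have hlim2 : Tendsto (fun s : ℕ => (s : ℝ) ^ a * ((s : ℝ) * (q ^ (s - 1) * ∫ z, |φ z| ∂ν)))
      atTop (𝓝 0) := by
    set k : ℕ := ⌈a⌉₊ + 1 with hk
    have h1 := ((tendsto_pow_const_mul_const_pow_of_lt_one k hq0 hq1).comp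
      (tendsto_sub_atTop_nat 1)).mul_const (2 ^ k * ∫ z, |φ z| ∂ν)
    rw [zero_mul] at h1
    refine squeeze_zero' (Eventually.of_forall fun s => by positivity) ?_ h1
    filter_upwards [eventually_ge_atTop 2] with s hs
    have hs1 : (1 : ℝ) ≤ s := by exact_mod_cast (by omega : 1 ≤ s)
    have h2 : (s : ℝ) ≤ 2 * ((s - 1 : ℕ) : ℝ) := by exact_mod_cast (by omega : s ≤ 2 * (s - 1))
    have h3 : (s : ℝ) ^ a * s ≤ (s : ℝ) ^ k := by
      rw [hk, pow_succ, ← Real.rpow_natCast]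
      gcongr
      exact Nat.le_ceil a
    have h4 : (s : ℝ) ^ k ≤ 2 ^ k * ((s - 1 : ℕ) : ℝ) ^ k := by
      rw [← mul_pow]; gcongr
    have hI : 0 ≤ q ^ (s - 1) * ∫ z, |φ z| ∂ν := by positivity
    calc (s : ℝ) ^ a * ((s : ℝ) * (q ^ (s - 1) * ∫ z, |φ z| ∂ν))
        = ((s : ℝ) ^ a * s) * (q ^ (s - 1) * ∫ z, |φ z| ∂ν) := by ring
      _ ≤ (2 ^ k * ((s - 1 : ℕ) : ℝ) ^ k) * (q ^ (s - 1) * ∫ z, |φ z| ∂ν) := by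
          exact mul_le_mul_of_nonneg_right (h3.trans h4) hI
      _ = _ := by simp only [Function.comp]; ring
  have hδG : δ * Real.Gamma (a + 1) = c / 4 := by rw [hδ]; field_simp
  rw [hδG] at hlim1
  filter_upwards [hlim1.eventually (eventually_le_nhds (show c / 4 < c / 2 by linarith)),
    hlim2.eventually (eventually_le_nhds (show (0 : ℝ) < c / 2 by linarith)),
    eventually_ge_atTop 1] with s h1 h2 hs
  have hspos : (0 : ℝ) < s := by exact_mod_cast hs
  have hsa : 0 < (s : ℝ) ^ a := Real.rpow_pos_of_pos hspos a
  rw [Real.norm_eq_abs, abs_mul, abs_of_pos hspos, Real.norm_of_nonneg (by positivity),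
    Real.rpow_neg hspos.le, ← div_eq_mul_inv, le_div_iff₀ hsa]
  calc (s : ℝ) * |∫ z, φ z * tailProb ν x z ^ (s - 1) ∂ν| * (s : ℝ) ^ a
      ≤ (s : ℝ) * (δ * (∫ z, (1 - tailProb ν x z) ^ a * tailProb ν x z ^ (s - 1) ∂ν) +
          q ^ (s - 1) * ∫ z, |φ z| ∂ν) * (s : ℝ) ^ a := by gcongr; exact hbound (s - 1)
    _ = δ * ((s : ℝ) ^ a *
          ((s : ℝ) * ∫ z, (1 - tailProb ν x z) ^ a * tailProb ν x z ^ (s - 1) ∂ν)) +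
        (s : ℝ) ^ a * ((s : ℝ) * (q ^ (s - 1) * ∫ z, |φ z| ∂ν)) := by ring
    _ ≤ c := by linarith

/-- If `φ` is integrable and behaves like `κ * U ^ a` at `x`, with `U = 1 - tailProb ν x`, then its
expectation at the nearest neighbour among `s` points is `κ Γ(a + 1) s ^ (-a)` to first order. -/
theorem integral_mul_tailProb_pow_sub_isLittleO [BorelSpace E]
    (hν : ∀ r, ν {w | dist w x = r} = 0) (hx : x ∈ ν.support) {a : ℝ} (ha : 0 ≤ a) {φ : E → ℝ}
    (hφ : Integrable φ ν) (κ : ℝ)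
    (hlo : (fun z => φ z - κ * (1 - tailProb ν x z) ^ a)
      =o[𝓝 x] fun z => (1 - tailProb ν x z) ^ a) :
    (fun s : ℕ => (s : ℝ) * ∫ z, φ z * tailProb ν x z ^ (s - 1) ∂ν -
      κ * Real.Gamma (a + 1) * (s : ℝ) ^ (-a)) =o[atTop] fun s : ℕ => (s : ℝ) ^ (-a) := by
  have hU := integrable_one_sub_tailProb_rpow (ν := ν) (x := x) ha
  have h1 := isLittleO_integral_mul_tailProb_pow hν hx ha (hφ.sub (hU.const_mul κ)) hlo
  have h2 : (fun s : ℕ => κ * ((s : ℝ) * ∫ z, (1 - tailProb ν x z) ^ a *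
      tailProb ν x z ^ (s - 1) ∂ν - Real.Gamma (a + 1) * (s : ℝ) ^ (-a)))
      =o[atTop] fun s : ℕ => (s : ℝ) ^ (-a) := by
    refine IsLittleO.const_mul_left ?_ κ
    have h3 := (tendsto_integral_rpow_mul_tailProb_pow hν ha).sub_const (Real.Gamma (a + 1))
    rw [sub_self] at h3
    have h4 := ((isLittleO_one_iff ℝ).2 h3).mul_isBigO
      (isBigO_refl (fun s : ℕ => (s : ℝ) ^ (-a)) atTop)
    refine (h4.congr' ?_ (by simp))
    filter_upwards [eventually_ge_atTop 1] with s hs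
    have hspos : (0 : ℝ) < s := by exact_mod_cast hs
    have := (Real.rpow_pos_of_pos hspos a).ne'
    rw [Real.rpow_neg hspos.le]
    field_simp
  refine (h1.add h2).congr_left fun s => ?_
  have h5 : ∀ z, (φ - fun z => κ * (1 - tailProb ν x z) ^ a) z * tailProb ν x z ^ (s - 1) =
      φ z * tailProb ν x z ^ (s - 1) -
        κ * ((1 - tailProb ν x z) ^ a * tailProb ν x z ^ (s - 1)) := fun z => by
    simp only [Pi.sub_apply]; ring
  simp_rw [h5]
  rw [integral_sub (integrable_mul_tailProb_pow hφ _)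
    ((integrable_mul_tailProb_pow hU _).const_mul κ), integral_const_mul]
  ring

end tailProb

/-! ### Weights of the observations -/

section weights

variable {d : ℕ}

open Classical in
/-- The indicator that the point `p i` is the nearest neighbour of `x` among the points with labels
in `S`. -/
noncomputable def nnInd (x : EuclideanSpace ℝ (Fin d)) (p : ℕ → EuclideanSpace ℝ (Fin d))
    (S : Finset ℕ) (i : ℕ) : ℝ :=
  if IsNearest x (fun j => (p j, 0)) S i then 1 else 0

/-- The weight of the `i`-th response in the estimator `dnn`: the proportion of those subsamples of
size `s` in which `p i` is the nearest neighbour of `x`. -/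
noncomputable def nnWeight (x : EuclideanSpace ℝ (Fin d)) (p : ℕ → EuclideanSpace ℝ (Fin d))
    (n s i : ℕ) : ℝ :=
  (n.choose s : ℝ)⁻¹ * ∑ S ∈ (Finset.range n).powersetCard s, nnInd x p S i

variable (x : EuclideanSpace ℝ (Fin d))

theorem nnInd_nonneg (p : ℕ → EuclideanSpace ℝ (Fin d)) (S : Finset ℕ) (i : ℕ) :
    0 ≤ nnInd x p S i := by
  unfold nnInd; split_ifs <;> simp

theorem nnInd_le_one (p : ℕ → EuclideanSpace ℝ (Fin d)) (S : Finset ℕ) (i : ℕ) :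
    nnInd x p S i ≤ 1 := by
  unfold nnInd; split_ifs <;> simp

theorem abs_nnInd_le_one (p : ℕ → EuclideanSpace ℝ (Fin d)) (S : Finset ℕ) (i : ℕ) :
    |nnInd x p S i| ≤ 1 :=
  (abs_of_nonneg (nnInd_nonneg x p S i)).trans_le (nnInd_le_one x p S i)

theorem nnInd_of_notMem (p : ℕ → EuclideanSpace ℝ (Fin d)) {S : Finset ℕ} {i : ℕ} (hi : i ∉ S) :
    nnInd x p S i = 0 :=
  if_neg fun h => hi h.1

theorem nnInd_mul_nnInd (p : ℕ → EuclideanSpace ℝ (Fin d)) {S T : Finset ℕ} {i : ℕ} (hS : i ∈ S)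
    (hT : i ∈ T) : nnInd x p S i * nnInd x p T i = nnInd x p (S ∪ T) i := by
  have h : IsNearest x (fun j => (p j, (0 : ℝ))) (S ∪ T) i ↔
      IsNearest x (fun j => (p j, (0 : ℝ))) S i ∧ IsNearest x (fun j => (p j, (0 : ℝ))) T i := by
    constructor
    · rintro ⟨-, h⟩
      exact ⟨⟨hS, fun j hj => h j (Finset.mem_union_left _ hj)⟩,
        ⟨hT, fun j hj => h j (Finset.mem_union_right _ hj)⟩⟩
    · rintro ⟨⟨-, h1⟩, -, h2⟩
      exact ⟨Finset.mem_union_left _ hS,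
        fun j hj => (Finset.mem_union.1 hj).elim (h1 j) (h2 j)⟩
  unfold nnInd
  by_cases h1 : IsNearest x (fun j => (p j, (0 : ℝ))) S i <;>
    by_cases h2 : IsNearest x (fun j => (p j, (0 : ℝ))) T i <;> simp [h1, h2, h]

theorem nnInd_congr {p p' : ℕ → EuclideanSpace ℝ (Fin d)} {S : Finset ℕ}
    (h : ∀ j ∈ S, p j = p' j) (i : ℕ) : nnInd x p S i = nnInd x p' S i := by
  have : IsNearest x (fun j => (p j, (0 : ℝ))) S i ↔
      IsNearest x (fun j => (p' j, (0 : ℝ))) S i := by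
    unfold IsNearest
    refine and_congr_right fun hi => forall₂_congr fun j hj => ?_
    simp only [h j hj, h i hi]
  unfold nnInd
  by_cases hp : IsNearest x (fun j => (p' j, (0 : ℝ))) S i
  · rw [if_pos hp, if_pos (this.2 hp)]
  · rw [if_neg hp, if_neg fun h' => hp (this.1 h')]

theorem measurable_nnInd (S : Finset ℕ) (i : ℕ) :
    Measurable fun p : ℕ → EuclideanSpace ℝ (Fin d) => nnInd x p S i := by
  classical
  unfold nnInd
  refine Measurable.ite ?_ measurable_const measurable_const
  unfold IsNearest
  simp only [Set.ofPred_and, Set.ofPred_forall]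
  refine (MeasurableSet.const _).inter (MeasurableSet.biInter S.countable_toSet fun j _ => ?_)
  have hdist : ∀ k, Measurable fun p : ℕ → EuclideanSpace ℝ (Fin d) => dist (p k) x :=
    fun k => (measurable_pi_apply k).dist measurable_const
  exact (measurableSet_lt (hdist i) (hdist j)).union
    ((measurableSet_eq_fun (hdist i) (hdist j)).inter (MeasurableSet.const _))

theorem measurable_nnWeight (n s i : ℕ) :
    Measurable fun p : ℕ → EuclideanSpace ℝ (Fin d) => nnWeight x p n s i :=
  (Finset.measurable_sum _ fun S _ => measurable_nnInd x S i).const_mul _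

theorem nnWeight_nonneg (p : ℕ → EuclideanSpace ℝ (Fin d)) (n s i : ℕ) :
    0 ≤ nnWeight x p n s i :=
  mul_nonneg (by positivity) (Finset.sum_nonneg fun S _ => nnInd_nonneg x p S i)

theorem nnWeight_le_one (p : ℕ → EuclideanSpace ℝ (Fin d)) (n s i : ℕ) :
    nnWeight x p n s i ≤ 1 := by
  have h : ∑ S ∈ (Finset.range n).powersetCard s, nnInd x p S i ≤ n.choose s := by
    simpa using Finset.sum_le_sum fun S (_ : S ∈ (Finset.range n).powersetCard s) =>
      nnInd_le_one x p S i
  exact inv_mul_le_one_of_le₀ h (by positivity)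

theorem nnEstimator_eq_sum (z : ℕ → EuclideanSpace ℝ (Fin d) × ℝ) (S : Finset ℕ) :
    nnEstimator x z S = ∑ i ∈ S, nnInd x (fun j => (z j).1) S i * (z i).2 := by
  unfold nnEstimator nnInd
  refine Finset.sum_congr rfl fun i _ => ?_
  rw [ite_mul, one_mul, zero_mul]
  rfl

theorem dnn_eq_sum_nnWeight (z : ℕ → EuclideanSpace ℝ (Fin d) × ℝ) (n s : ℕ) :
    dnn x z n s = ∑ i ∈ Finset.range n, nnWeight x (fun j => (z j).1) n s i * (z i).2 := by
  simp only [dnn, nnWeight, mul_assoc, ← Finset.mul_sum, Finset.sum_mul]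
  rw [Finset.sum_comm]
  congr 1
  refine Finset.sum_congr rfl fun S hS => ?_
  rw [nnEstimator_eq_sum]
  refine Finset.sum_subset (Finset.mem_powersetCard.1 hS).1 fun i _ hi => ?_
  rw [nnInd_of_notMem x _ hi, zero_mul]

end weights

/-! ### Counting subsamples -/

theorem card_filter_subset_powersetCard {α : Type*} [DecidableEq α] {A R : Finset α}
    (hA : A ⊆ R) {s : ℕ} (hs : A.card ≤ s) :
    ((R.powersetCard s).filter (A ⊆ ·)).card = (R.card - A.card).choose (s - A.card) := by
  rw [← Finset.card_sdiff_of_subset hA, ← Finset.card_powersetCard]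
  refine Finset.card_nbij' (· \ A) (· ∪ A) ?_ ?_ ?_ ?_
  · intro T hT
    simp only [Finset.coe_filter, Finset.mem_powersetCard, Set.mem_ofPred_eq] at hT
    exact Finset.mem_coe.2 <| Finset.mem_powersetCard.2 ⟨Finset.sdiff_subset_sdiff hT.1.1 le_rfl, by
      rw [Finset.card_sdiff_of_subset hT.2, hT.1.2]⟩
  · intro T hT
    have hT := Finset.mem_powersetCard.1 (Finset.mem_coe.1 hT)
    refine Finset.mem_coe.2 (Finset.mem_filter.2 ⟨Finset.mem_powersetCard.2 ⟨?_, ?_⟩, ?_⟩)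
    · exact Finset.union_subset (hT.1.trans Finset.sdiff_subset) hA
    · rw [Finset.card_union_of_disjoint (Finset.disjoint_of_subset_left hT.1
        Finset.sdiff_disjoint), hT.2, Nat.sub_add_cancel hs]
    · exact Finset.subset_union_right
  · intro T hT
    exact Finset.sdiff_union_of_subset (Finset.mem_filter.1 (Finset.mem_coe.1 hT)).2
  · intro T hT
    have hT := Finset.mem_powersetCard.1 (Finset.mem_coe.1 hT)
    exact Finset.union_sdiff_cancel_right (Finset.disjoint_of_subset_left hT.1
        Finset.sdiff_disjoint)

/-- For fixed `S ∋ i`, the total excess `|S ∩ T| - 1` over the sets `T ∋ i` of size `s`, relative to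
the number of those `T`: the excess of a random `T` has mean `(s - 1)² / (n - 1)`. -/
theorem sum_card_inter_sub_one {n s i : ℕ} (hs : 1 ≤ s) (hsn : s ≤ n) {S : Finset ℕ}
    (hS : S ⊆ Finset.range n) (hcard : S.card = s) (hi : i ∈ S) :
    ((n : ℝ) - 1) * ∑ T ∈ ((Finset.range n).powersetCard s).filter (i ∈ ·),
      (((S ∩ T).card : ℝ) - 1) = ((s : ℝ) - 1) ^ 2 * ((n - 1).choose (s - 1) : ℝ) := by
  have h1 : ∀ T ∈ ((Finset.range n).powersetCard s).filter (i ∈ ·),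
      ((S ∩ T).card : ℝ) - 1 = ∑ j ∈ S.erase i, if j ∈ T then (1 : ℝ) else 0 := by
    intro T hT
    have hiT := (Finset.mem_filter.1 hT).2
    rw [Finset.sum_ite_mem, Finset.sum_const, nsmul_eq_mul, mul_one, Finset.erase_inter,
      Finset.card_erase_of_mem (Finset.mem_inter.2 ⟨hi, hiT⟩), Nat.cast_pred]
    exact Finset.card_pos.2 ⟨i, Finset.mem_inter.2 ⟨hi, hiT⟩⟩
  rw [Finset.sum_congr rfl h1, Finset.sum_comm]
  rcases hs.eq_or_lt with rfl | hs2
  · have : S.erase i = ∅ := by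
      rw [← Finset.card_eq_zero, Finset.card_erase_of_mem hi, hcard]
    simp [this]
  have h2 : ∀ j ∈ S.erase i, (∑ T ∈ ((Finset.range n).powersetCard s).filter (i ∈ ·),
      if j ∈ T then (1 : ℝ) else 0) = ((n - 2).choose (s - 2) : ℝ) := by
    intro j hj
    obtain ⟨hji, hjS⟩ := Finset.mem_erase.1 hj
    rw [← Finset.sum_filter, Finset.sum_const, nsmul_eq_mul, mul_one, Finset.filter_filter]
    have hc : ({i, j} : Finset ℕ).card = 2 := Finset.card_pair hji.symm
    have h3 := card_filter_subset_powersetCard (A := {i, j}) (R := Finset.range n) (s := s)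
      (by intro k hk; rcases Finset.mem_insert.1 hk with rfl | hk
          · exact hS hi
          · rw [Finset.mem_singleton.1 hk]; exact hS hjS) (by rw [hc]; exact hs2)
    rw [hc, Finset.card_range] at h3
    rw [← h3]
    congr 3
    ext T
    simp [Finset.insert_subset_iff]
  rw [Finset.sum_congr rfl h2, Finset.sum_const, nsmul_eq_mul, Finset.card_erase_of_mem hi, hcard]
  obtain ⟨a, rfl⟩ := Nat.exists_eq_add_of_le' hs2
  obtain ⟨b, rfl⟩ := Nat.exists_eq_add_of_le' (show 2 ≤ n by omega)
  have h4 : ((b + 1 : ℕ) : ℝ) * (b.choose a : ℝ) =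
      ((b + 1).choose (a + 1) : ℝ) * ((a + 1 : ℕ) : ℝ) := by
    exact_mod_cast Nat.add_one_mul_choose_eq b a
  simp only [Nat.succ_eq_add_one, show a + 1 + 1 - 2 = a by omega,
    show b + 2 - 2 = b by omega, show b + 2 - 1 = b + 1 by omega] at *
  push_cast at *
  linear_combination ((a : ℝ) + 1) * h4

/-! ### Averages over subsamples of a given size -/

theorem exists_perm_map_eq {α : Type*} [Fintype α] [DecidableEq α] {S T : Finset α}
    (h : S.card = T.card) : ∃ τ : Equiv.Perm α, S.map τ.toEmbedding = T := by
  have e : {a // a ∈ S} ≃ {a // a ∈ T} := Finset.equivOfCardEq h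
  refine ⟨e.extendSubtype, ?_⟩
  refine Finset.eq_of_subset_of_card_le (fun b hb => ?_) (by rw [Finset.card_map, h])
  obtain ⟨a, ha, rfl⟩ := Finset.mem_map.1 hb
  exact e.extendSubtype_mem a ha

theorem choose_mul_sum_perm {α : Type*} [Fintype α] [DecidableEq α] (g : Finset α → ℝ)
    (S : Finset α) :
    ((Fintype.card α).choose S.card : ℝ) * ∑ π : Equiv.Perm α, g (S.map π.toEmbedding) =
      (Fintype.card (Equiv.Perm α) : ℝ) *
        ∑ T ∈ (Finset.univ : Finset α).powersetCard S.card, g T := by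
  have h1 : ∀ T ∈ (Finset.univ : Finset α).powersetCard S.card,
      ∑ π : Equiv.Perm α, g (T.map π.toEmbedding) =
        ∑ π : Equiv.Perm α, g (S.map π.toEmbedding) := by
    intro T hT
    obtain ⟨τ, rfl⟩ := exists_perm_map_eq (Finset.mem_powersetCard.1 hT).2.symm
    rw [← Equiv.sum_comp (Equiv.mulRight τ) fun π => g (S.map π.toEmbedding)]
    refine Finset.sum_congr rfl fun π _ => ?_
    rw [Finset.map_map]
    rfl
  have h2 : ∀ π : Equiv.Perm α, ∑ T ∈ (Finset.univ : Finset α).powersetCard S.card,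
      g (T.map π.toEmbedding) = ∑ T ∈ (Finset.univ : Finset α).powersetCard S.card, g T := by
    intro π
    refine Finset.sum_equiv π.finsetCongr (fun T => ?_) fun T _ => rfl
    simp [Finset.mem_powersetCard]
  have h3 := Finset.sum_congr rfl h1
  rw [Finset.sum_const, Finset.card_powersetCard, Finset.card_univ, nsmul_eq_mul,
    Finset.sum_comm, Finset.sum_congr rfl fun π _ => h2 π, Finset.sum_const, nsmul_eq_mul,
    Finset.card_univ] at h3
  exact h3.symm

/-- Hoeffding's bound for the second moment of a `U`-statistic: such a statistic is an average over
permutations of means of `⌊n / s⌋` uncorrelated terms, and averaging does not increase the second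
moment. -/
theorem integral_sq_average_powersetCard_le {Ω : Type*} [MeasurableSpace Ω] (P : Measure Ω)
    {n s : ℕ} (hs : 1 ≤ s) (hsn : s ≤ n) (F : Finset ℕ → Ω → ℝ) {v : ℝ}
    (hF : ∀ S ∈ (Finset.range n).powersetCard s, MemLp (F S) 2 P)
    (hv : ∀ S ∈ (Finset.range n).powersetCard s, ∫ ω, F S ω ^ 2 ∂P ≤ v)
    (h0 : ∀ S ∈ (Finset.range n).powersetCard s, ∀ T ∈ (Finset.range n).powersetCard s,
      Disjoint S T → ∫ ω, F S ω * F T ω ∂P = 0) :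
    ∫ ω, ((n.choose s : ℝ)⁻¹ * ∑ S ∈ (Finset.range n).powersetCard s, F S ω) ^ 2 ∂P ≤
      2 * (s : ℝ) / n * v := by
  classical
  set k : ℕ := n / s with hk
  have hk1 : 1 ≤ k := Nat.div_pos hsn hs
  -- consecutive blocks of length `s`; the last, incomplete one is not used
  let B : ℕ → Finset (Fin n) := fun j => Finset.univ.filter fun i => i.1 / s = j
  have hBmap : ∀ j < k, (B j).map Fin.valEmbedding = Finset.Ico (s * j) (s * (j + 1)) := by
    intro j hj
    have hjn : s * (j + 1) ≤ n := (Nat.mul_le_mul_left s hj).trans (Nat.mul_div_le n s)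
    ext i
    simp only [B, Finset.mem_map, Finset.mem_filter, Finset.mem_univ, true_and, Finset.mem_Ico,
      Fin.valEmbedding_apply, Nat.div_eq_iff hs]
    constructor
    · rintro ⟨a, ha, rfl⟩
      have : s * (j + 1) = j * s + s := by ring
      constructor
      · rw [mul_comm]; exact ha.1
      · omega
    · rintro ⟨h1, h2⟩
      refine ⟨⟨i, by omega⟩, ⟨by nlinarith, ?_⟩, rfl⟩
      have : s * (j + 1) = j * s + s := by ring
      simp only
      omega
  have hBcard : ∀ j < k, (B j).card = s := by
    intro j hj
    rw [← Finset.card_map Fin.valEmbedding, hBmap j hj, Nat.card_Ico, ← Nat.mul_sub]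
    simp
  let G : Equiv.Perm (Fin n) → ℕ → Finset ℕ := fun π j =>
    ((B j).map π.toEmbedding).map Fin.valEmbedding
  have hGmem : ∀ π, ∀ j < k, G π j ∈ (Finset.range n).powersetCard s := by
    intro π j hj
    refine Finset.mem_powersetCard.2 ⟨fun i hi => ?_, by simp [G, hBcard j hj]⟩
    obtain ⟨a, -, rfl⟩ := Finset.mem_map.1 hi
    exact Finset.mem_range.2 a.2
  have hGdisj : ∀ π, ∀ j j', j ≠ j' → Disjoint (G π j) (G π j') := by
    intro π j j' hjj
    rw [Finset.disjoint_map, Finset.disjoint_map]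
    refine Finset.disjoint_left.2 fun i hi hi' => hjj ?_
    rw [← (Finset.mem_filter.1 hi).2, ← (Finset.mem_filter.1 hi').2]
  have hN : (0 : ℝ) < (n.choose s : ℝ) := by exact_mod_cast Nat.choose_pos hsn
  have hM : (0 : ℝ) < (Fintype.card (Equiv.Perm (Fin n)) : ℝ) := by
    exact_mod_cast Fintype.card_pos
  set M : ℝ := (Fintype.card (Equiv.Perm (Fin n)) : ℝ) with hMdef
  have hkpos : (0 : ℝ) < k := by exact_mod_cast hk1
  -- the `U`-statistic as an average over permutations of means over disjoint blocks
  have havg : ∀ ω, (n.choose s : ℝ)⁻¹ * ∑ S ∈ (Finset.range n).powersetCard s, F S ω =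
      M⁻¹ * (k : ℝ)⁻¹ * ∑ π : Equiv.Perm (Fin n), ∑ j ∈ Finset.range k, F (G π j) ω := by
    intro ω
    have hsum : ∑ S ∈ (Finset.range n).powersetCard s, F S ω =
        ∑ T ∈ (Finset.univ : Finset (Fin n)).powersetCard s, F (T.map Fin.valEmbedding) ω := by
      have : Finset.range n = (Finset.univ : Finset (Fin n)).map Fin.valEmbedding := by
        rw [Fin.map_valEmbedding_univ]
        ext; simp
      rw [this, Finset.powersetCard_map, Finset.sum_map]
      rfl
    have hj : ∀ j ∈ Finset.range k, ∑ π : Equiv.Perm (Fin n), F (G π j) ω =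
        (n.choose s : ℝ)⁻¹ * (M * ∑ S ∈ (Finset.range n).powersetCard s, F S ω) := by
      intro j hj
      have h := choose_mul_sum_perm (fun T : Finset (Fin n) => F (T.map Fin.valEmbedding) ω) (B j)
      rw [hBcard j (Finset.mem_range.1 hj), Fintype.card_fin, ← hsum] at h
      rw [← h, inv_mul_cancel_left₀ hN.ne']
    rw [Finset.sum_comm, Finset.sum_congr rfl hj, Finset.sum_const, Finset.card_range,
      nsmul_eq_mul]
    field_simp
  have hint : ∀ π, ∀ j < k, ∀ j' < k,
      Integrable (fun ω => F (G π j) ω * F (G π j') ω) P := fun π j hj j' hj' =>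
    (hF _ (hGmem π j hj)).integrable_mul (hF _ (hGmem π j' hj'))
  have hsq : ∀ π ω, (∑ j ∈ Finset.range k, F (G π j) ω) ^ 2 =
      ∑ j ∈ Finset.range k, ∑ j' ∈ Finset.range k, F (G π j) ω * F (G π j') ω := by
    intro π ω
    rw [sq, Finset.sum_mul_sum]
  have hsqint : ∀ π, Integrable (fun ω => (∑ j ∈ Finset.range k, F (G π j) ω) ^ 2) P := by
    intro π
    simp_rw [hsq]
    exact integrable_finsetSum _ fun j hj => integrable_finsetSum _ fun j' hj' =>
      hint π j (Finset.mem_range.1 hj) j' (Finset.mem_range.1 hj')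
  have hsqle : ∀ π, ∫ ω, (∑ j ∈ Finset.range k, F (G π j) ω) ^ 2 ∂P ≤ k * v := by
    intro π
    simp_rw [hsq]
    rw [integral_finsetSum _ fun j hj => integrable_finsetSum _ fun j' hj' =>
      hint π j (Finset.mem_range.1 hj) j' (Finset.mem_range.1 hj')]
    have : ∀ j ∈ Finset.range k,
        ∫ ω, ∑ j' ∈ Finset.range k, F (G π j) ω * F (G π j') ω ∂P ≤ v := by
      intro j hj
      rw [integral_finsetSum _ fun j' hj' =>
        hint π j (Finset.mem_range.1 hj) j' (Finset.mem_range.1 hj'),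
        Finset.sum_eq_single_of_mem j hj fun j' hj' hne =>
          h0 _ (hGmem π j (Finset.mem_range.1 hj)) _ (hGmem π j' (Finset.mem_range.1 hj'))
            (hGdisj π j j' hne.symm)]
      simpa only [sq] using hv _ (hGmem π j (Finset.mem_range.1 hj))
    simpa using Finset.sum_le_sum this
  have hpt : ∀ ω, ((n.choose s : ℝ)⁻¹ * ∑ S ∈ (Finset.range n).powersetCard s, F S ω) ^ 2 ≤
      M⁻¹ * ((k : ℝ)⁻¹) ^ 2 *
        ∑ π : Equiv.Perm (Fin n), (∑ j ∈ Finset.range k, F (G π j) ω) ^ 2 := by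
    intro ω
    rw [havg, mul_pow]
    have h := sq_sum_le_card_mul_sum_sq (s := (Finset.univ : Finset (Equiv.Perm (Fin n))))
      (f := fun π => ∑ j ∈ Finset.range k, F (G π j) ω)
    rw [Finset.card_univ, ← hMdef] at h
    calc (M⁻¹ * (k : ℝ)⁻¹) ^ 2 *
        (∑ π : Equiv.Perm (Fin n), ∑ j ∈ Finset.range k, F (G π j) ω) ^ 2
        ≤ (M⁻¹ * (k : ℝ)⁻¹) ^ 2 *
          (M * ∑ π : Equiv.Perm (Fin n), (∑ j ∈ Finset.range k, F (G π j) ω) ^ 2) := by gcongr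
      _ = _ := by field_simp
  have hv0 : 0 ≤ v := (integral_nonneg fun ω => sq_nonneg _).trans (hv _ (hGmem 1 0 hk1))
  -- the constant `2` pays for the rounding of `n / s`
  have hnk : (n : ℝ) ≤ 2 * s * k := by
    have h1 : n < s * (k + 1) := Nat.lt_mul_div_succ n hs
    have h2 : s * (k + 1) ≤ 2 * s * k := by nlinarith
    exact_mod_cast (h1.trans_le h2).le
  have hn : (0 : ℝ) < n := by exact_mod_cast (lt_of_lt_of_le hs hsn)
  calc ∫ ω, ((n.choose s : ℝ)⁻¹ * ∑ S ∈ (Finset.range n).powersetCard s, F S ω) ^ 2 ∂P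
      ≤ ∫ ω, M⁻¹ * ((k : ℝ)⁻¹) ^ 2 *
          ∑ π : Equiv.Perm (Fin n), (∑ j ∈ Finset.range k, F (G π j) ω) ^ 2 ∂P :=
        integral_mono_of_nonneg (ae_of_all _ fun _ => sq_nonneg _)
          ((integrable_finsetSum _ fun π _ => hsqint π).const_mul _) (ae_of_all _ hpt)
    _ = M⁻¹ * ((k : ℝ)⁻¹) ^ 2 *
          ∑ π : Equiv.Perm (Fin n), ∫ ω, (∑ j ∈ Finset.range k, F (G π j) ω) ^ 2 ∂P := by
        rw [integral_const_mul, integral_finsetSum _ fun π _ => hsqint π]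
    _ ≤ M⁻¹ * ((k : ℝ)⁻¹) ^ 2 * ∑ π : Equiv.Perm (Fin n), (k : ℝ) * v := by
        gcongr with π; exact hsqle π
    _ = v / k := by
        rw [Finset.sum_const, Finset.card_univ, nsmul_eq_mul, ← hMdef]; field_simp
    _ ≤ 2 * (s : ℝ) / n * v := by
        rw [div_mul_eq_mul_div, div_le_div_iff₀ hkpos hn]
        nlinarith

/-! ### The law of the nearest neighbour -/

section nearest

variable {d : ℕ} {Ω : Type*} [MeasurableSpace Ω] {P : Measure Ω} [IsProbabilityMeasure P]
  {X : ℕ → Ω → EuclideanSpace ℝ (Fin d)} {ν : Measure (EuclideanSpace ℝ (Fin d))}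
  {x : EuclideanSpace ℝ (Fin d)}

/-- The expectation of `h (X i)` on the event that `X i` is the nearest neighbour among the points
with labels in `S`: conditionally on `X i`, each of the other points is farther with probability
`tailProb ν x (X i)`. Ties do not matter because spheres are null sets. -/
theorem integral_mul_nnInd (hX : ∀ i, Measurable (X i)) (hind : iIndepFun X P)
    (hlaw : ∀ i, P.map (X i) = ν) (hν : ∀ r, ν {w | dist w x = r} = 0) {S : Finset ℕ} {i : ℕ}
    (hi : i ∈ S) {h : EuclideanSpace ℝ (Fin d) → ℝ} (hh : Integrable h ν) :
    ∫ ω, h (X i ω) * nnInd x (fun j => X j ω) S i ∂P =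
      ∫ z, h z * tailProb ν x z ^ (S.card - 1) ∂ν := by
  classical
  have : IsProbabilityMeasure ν := hlaw i ▸ Measure.isProbabilityMeasure_map (hX i).aemeasurable
  set R := S.erase i with hR
  let W : Ω → R → EuclideanSpace ℝ (Fin d) := fun ω j => X j ω
  have hW : Measurable W := measurable_pi_lambda _ fun j => hX j
  have : IsProbabilityMeasure (P.map W) := Measure.isProbabilityMeasure_map hW.aemeasurable
  have hindW : IndepFun (X i) W P := by
    have h1 := hind.indepFun_finset {i} R (by simp [hR]) hX
    exact h1.comp (measurable_pi_apply (⟨i, Finset.mem_singleton_self i⟩ : ({i} : Finset ℕ)))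
      measurable_id
  -- the points that rank behind `z` when they carry the label `j` and `z` carries the label `i`
  let C : ℕ → EuclideanSpace ℝ (Fin d) → Set (EuclideanSpace ℝ (Fin d)) := fun j z =>
    {w | dist z x < dist w x ∨ (dist z x = dist w x ∧ i ≤ j)}
  let A : Set (EuclideanSpace ℝ (Fin d) × (R → EuclideanSpace ℝ (Fin d))) :=
    {q | ∀ j : R, q.2 j ∈ C j q.1}
  have hC : ∀ j z, MeasurableSet (C j z) := fun j z =>
    (measurableSet_lt measurable_const (measurable_id.dist measurable_const)).union
      ((measurableSet_eq_fun measurable_const (measurable_id.dist measurable_const)).inter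
        (MeasurableSet.const _))
  have hA : MeasurableSet A := by
    have h1 : Measurable fun q : EuclideanSpace ℝ (Fin d) × (R → EuclideanSpace ℝ (Fin d)) =>
      dist q.1 x := by fun_prop
    have h2 : ∀ j : R, Measurable
        fun q : EuclideanSpace ℝ (Fin d) × (R → EuclideanSpace ℝ (Fin d)) =>
          dist (q.2 j) x := fun j => by fun_prop
    have : A = ⋂ j : R, {q | q.2 j ∈ C j q.1} := by ext q; simp [A]
    rw [this]
    exact MeasurableSet.iInter fun j => (measurableSet_lt h1 (h2 j)).union
      ((measurableSet_eq_fun h1 (h2 j)).inter (MeasurableSet.const _))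
  have hCν : ∀ j z, ν.real (C j z) = tailProb ν x z := by
    intro j z
    refine measureReal_congr ?_
    have : ∀ᵐ w ∂ν, dist w x ≠ dist z x := by
      rw [ae_iff]; simpa using hν (dist z x)
    filter_upwards [this] with w hw
    refine propext ⟨fun h => h.elim id fun h => absurd h.1.symm hw, fun h => Or.inl h⟩
  have hQ : ∀ z, (P.map W).real {w | (z, w) ∈ A} = tailProb ν x z ^ (S.card - 1) := by
    intro z
    have hpre : W ⁻¹' {w | (z, w) ∈ A} = ⋂ j ∈ R, X j ⁻¹' C j z := by
      ext ω
      simp [A, W, C]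
    rw [map_measureReal_apply hW (show MeasurableSet {w | (z, w) ∈ A} from
      measurable_prodMk_left hA), hpre, Measure.real,
      hind.measure_inter_preimage_eq_mul _ (fun j _ => hC j z), ENNReal.toReal_prod]
    have h2 : ∀ j ∈ R, (P (X j ⁻¹' C j z)).toReal = tailProb ν x z := fun j _ => by
      rw [← hCν j z, Measure.real, ← hlaw j, Measure.map_apply (hX j) (hC j z)]
    rw [Finset.prod_congr rfl h2, Finset.prod_const, Finset.card_erase_of_mem hi]
  have hnn : ∀ ω, nnInd x (fun j => X j ω) S i = A.indicator 1 (X i ω, W ω) := by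
    intro ω
    have : IsNearest x (fun j => (X j ω, (0 : ℝ))) S i ↔ (X i ω, W ω) ∈ A := by
      constructor
      · exact fun h j => h.2 j (Finset.mem_of_mem_erase j.2)
      · refine fun h => ⟨hi, fun j hj => ?_⟩
        by_cases hji : j = i
        · subst hji; exact Or.inr ⟨rfl, le_rfl⟩
        · exact h ⟨j, Finset.mem_erase.2 ⟨hji, hj⟩⟩
    unfold nnInd
    by_cases hA' : (X i ω, W ω) ∈ A
    · rw [if_pos (this.2 hA'), Set.indicator_of_mem hA', Pi.one_apply]
    · rw [if_neg fun h' => hA' (this.1 h'), Set.indicator_of_notMem hA']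
  have hprod : P.map (fun ω => (X i ω, W ω)) = ν.prod (P.map W) := by
    rw [hindW.map_prod_eq_prod_map_map (hX i).aemeasurable hW.aemeasurable, hlaw i]
  have hind1 : Measurable (A.indicator
      (1 : EuclideanSpace ℝ (Fin d) × (R → EuclideanSpace ℝ (Fin d)) → ℝ)) :=
    measurable_one.indicator hA
  have hint : Integrable (fun q : EuclideanSpace ℝ (Fin d) × (R → EuclideanSpace ℝ (Fin d)) =>
      h q.1 * A.indicator 1 q) (ν.prod (P.map W)) := by
    refine (hh.comp_fst _).mul_bdd (c := 1) hind1.aestronglyMeasurable (ae_of_all _ fun q => ?_)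
    refine (norm_indicator_le_norm_self _ _).trans (by simp)
  simp_rw [hnn]
  have hmap := integral_map (μ := P) (φ := fun ω => (X i ω, W ω))
    ((hX i).prodMk hW).aemeasurable (f := fun q => h q.1 * A.indicator 1 q)
    (by rw [hprod]; exact hint.aestronglyMeasurable)
  rw [← hmap, hprod, integral_prod _ hint]
  refine integral_congr_ae (ae_of_all _ fun z => ?_)
  simp only
  rw [integral_const_mul, ← hQ z, ← integral_indicator_one (show MeasurableSet {w | (z, w) ∈ A} from
    measurable_prodMk_left hA)]
  rfl

theorem integral_nnInd (hX : ∀ i, Measurable (X i)) (hind : iIndepFun X P)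
    (hlaw : ∀ i, P.map (X i) = ν) (hν : ∀ r, ν {w | dist w x = r} = 0) {S : Finset ℕ} {i : ℕ}
    (hi : i ∈ S) : ∫ ω, nnInd x (fun j => X j ω) S i ∂P = 1 / (S.card : ℝ) := by
  have : IsProbabilityMeasure ν := hlaw i ▸ Measure.isProbabilityMeasure_map (hX i).aemeasurable
  have h := integral_mul_nnInd hX hind hlaw hν hi (integrable_const (1 : ℝ))
  simp only [one_mul] at h
  rw [h, integral_tailProb_pow hν, ← Nat.cast_add_one,
    Nat.sub_add_cancel (Finset.card_pos.2 ⟨i, hi⟩)]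

theorem integral_tailProb_pow_mul_nnInd (hX : ∀ i, Measurable (X i)) (hind : iIndepFun X P)
    (hlaw : ∀ i, P.map (X i) = ν) (hν : ∀ r, ν {w | dist w x = r} = 0) {S : Finset ℕ} {i : ℕ}
    (hi : i ∈ S) (m : ℕ) :
    ∫ ω, tailProb ν x (X i ω) ^ m * nnInd x (fun j => X j ω) S i ∂P =
      1 / ((m : ℝ) + S.card) := by
  have : IsProbabilityMeasure ν := hlaw i ▸ Measure.isProbabilityMeasure_map (hX i).aemeasurable
  rw [integral_mul_nnInd hX hind hlaw hν hi (integrable_tailProb_pow m)]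
  simp_rw [← pow_add]
  rw [integral_tailProb_pow hν]
  have := Finset.card_pos.2 ⟨i, hi⟩
  rw [Nat.cast_add, Nat.cast_sub this]
  congr 1
  push_cast
  ring

end nearest

/-! ### The noise -/

section noise

variable {Ω : Type*} [MeasurableSpace Ω] {P : Measure Ω}

/-- If the pairs `(X i, ε i)` are independent and each `ε i` is independent of `X i`, then the
whole sequence of the `ε i` is independent of the whole sequence of the `X i`. -/
theorem indepFun_seq_of_iIndepFun_prodMk [IsProbabilityMeasure P] {E F : Type*}
    [MeasurableSpace E] [MeasurableSpace F]
    {X : ℕ → Ω → E} {ε : ℕ → Ω → F} (hX : ∀ i, Measurable (X i)) (hε : ∀ i, Measurable (ε i))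
    (hXε : ∀ i, IndepFun (X i) (ε i) P) (hind : iIndepFun (fun i ω => (X i ω, ε i ω)) P) :
    IndepFun (fun ω i => X i ω) (fun ω i => ε i ω) P := by
  classical
  have key : ∀ K : Finset ℕ, IndepFun (fun ω (i : K) => X i ω) (fun ω (i : K) => ε i ω) P := by
    intro K
    have hmX : Measurable fun ω (i : K) => X i ω := measurable_pi_lambda _ fun i => hX i
    have hmε : Measurable fun ω (i : K) => ε i ω := measurable_pi_lambda _ fun i => hε i
    have hpr : ∀ i, IsProbabilityMeasure (P.map (X i)) := fun i =>
      Measure.isProbabilityMeasure_map (hX i).aemeasurable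
    have hpr' : ∀ i, IsProbabilityMeasure (P.map (ε i)) := fun i =>
      Measure.isProbabilityMeasure_map (hε i).aemeasurable
    rw [indepFun_iff_map_prod_eq_prod_map_map hmX.aemeasurable hmε.aemeasurable]
    have h1 : P.map (fun ω (i : K) => (X i ω, ε i ω)) =
        Measure.pi fun i : K => (P.map (X i)).prod (P.map (ε i)) := by
      have := (hind.precomp (g := fun i : K => (i : ℕ)) Subtype.val_injective).map_fun_eq_pi_map
        fun i : K => ((hX i).prodMk (hε i)).aemeasurable
      rw [this]
      congr 1
      funext i
      exact (hXε i).map_prod_eq_prod_map_map (hX i).aemeasurable (hε i).aemeasurable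
    have h2 := (measurePreserving_arrowProdEquivProdArrow E F K (fun i => P.map (X i))
      (fun i => P.map (ε i))).map_eq
    rw [← h1, Measure.map_map (MeasurableEquiv.measurable _)
      (measurable_pi_lambda _ fun i : K => (hX i).prodMk (hε i))] at h2
    have h3 := (hind.precomp (g := fun i : K => (i : ℕ)) Subtype.val_injective)
    have hiX : iIndepFun (fun (i : K) => X i) P :=
      h3.comp (fun _ => Prod.fst) fun _ => measurable_fst
    have hiε : iIndepFun (fun (i : K) => ε i) P :=
      h3.comp (fun _ => Prod.snd) fun _ => measurable_snd
    rw [hiX.map_fun_eq_pi_map fun i : K => (hX i).aemeasurable,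
      hiε.map_fun_eq_pi_map fun i : K => (hε i).aemeasurable]
    exact h2
  refine IndepFun.process_indepFun_process hX hε fun I J => ?_
  exact (key (I ∪ J)).comp
    (φ := fun f (i : I) => f ⟨i, Finset.mem_union_left _ i.2⟩)
    (ψ := fun f (j : J) => f ⟨j, Finset.mem_union_right _ j.2⟩)
    (measurable_pi_lambda _ fun i => measurable_pi_apply _)
    (measurable_pi_lambda _ fun j => measurable_pi_apply _)

variable {S : Type*} [MeasurableSpace S] {ξ : Ω → S} {ε : ℕ → Ω → ℝ}

theorem memLp_sum_mul {p : ENNReal} (hξ : Measurable ξ) (hε2 : ∀ i, MemLp (ε i) p P)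
    {a : ℕ → S → ℝ} (ha : ∀ i, Measurable (a i)) (hb : ∀ i z, |a i z| ≤ 1) (n : ℕ) :
    MemLp (fun ω => ∑ i ∈ Finset.range n, a i (ξ ω) * ε i ω) p P := by
  refine memLp_finsetSum _ fun i _ => ?_
  refine (hε2 i).of_le (((ha i).comp hξ).aestronglyMeasurable.mul (hε2 i).1)
    (ae_of_all _ fun ω => ?_)
  rw [norm_mul]
  exact mul_le_of_le_one_left (norm_nonneg _) (hb i _)

theorem integral_sum_mul_eq_zero (hξ : Measurable ξ) (hε : ∀ i, Measurable (ε i))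
    (hind : IndepFun ξ (fun ω i => ε i ω) P) (hε1 : ∀ i, Integrable (ε i) P)
    (hmean : ∀ i, ∫ ω, ε i ω ∂P = 0) {a : ℕ → S → ℝ} (ha : ∀ i, Measurable (a i))
    (hb : ∀ i z, |a i z| ≤ 1) (n : ℕ) :
    ∫ ω, ∑ i ∈ Finset.range n, a i (ξ ω) * ε i ω ∂P = 0 := by
  rw [integral_finsetSum]
  · refine Finset.sum_eq_zero fun i _ => ?_
    have h := hind.integral_fun_comp_mul_comp (f := a i) (g := fun e => e i) hξ.aemeasurable
      (measurable_pi_lambda _ hε).aemeasurable (ha i).aestronglyMeasurable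
      (measurable_pi_apply i).aestronglyMeasurable
    rw [h, hmean, mul_zero]
  · intro i _
    exact (hε1 i).bdd_mul (c := 1) ((ha i).comp hξ).aestronglyMeasurable
      (ae_of_all _ fun ω => hb i _)

/-- The variance of a sum of uncorrelated noises with random weights independent of the noises. -/
theorem integral_sq_sum_mul (hξ : Measurable ξ) (hε : ∀ i, Measurable (ε i))
    (hind : IndepFun ξ (fun ω i => ε i ω) P) (hε2 : ∀ i, MemLp (ε i) 2 P) {v : ℝ}
    (hvar : ∀ i, ∫ ω, ε i ω ^ 2 ∂P = v) (hcov : ∀ i j, i ≠ j → ∫ ω, ε i ω * ε j ω ∂P = 0)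
    {a : ℕ → S → ℝ} (ha : ∀ i, Measurable (a i)) (hb : ∀ i z, |a i z| ≤ 1) (n : ℕ) :
    ∫ ω, (∑ i ∈ Finset.range n, a i (ξ ω) * ε i ω) ^ 2 ∂P =
      v * ∑ i ∈ Finset.range n, ∫ ω, a i (ξ ω) ^ 2 ∂P := by
  have hexp : ∀ ω, (∑ i ∈ Finset.range n, a i (ξ ω) * ε i ω) ^ 2 = ∑ i ∈ Finset.range n,
      ∑ j ∈ Finset.range n, (a i (ξ ω) * a j (ξ ω)) * (ε i ω * ε j ω) := by
    intro ω
    rw [sq, Finset.sum_mul_sum]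
    exact Finset.sum_congr rfl fun i _ => Finset.sum_congr rfl fun j _ => by ring
  have hint : ∀ i j, Integrable (fun ω => (a i (ξ ω) * a j (ξ ω)) * (ε i ω * ε j ω)) P := by
    intro i j
    refine ((hε2 i).integrable_mul (hε2 j)).bdd_mul (c := 1)
      (((ha i).comp hξ).mul ((ha j).comp hξ)).aestronglyMeasurable (ae_of_all _ fun ω => ?_)
    rw [norm_mul]
    exact mul_le_one₀ (hb i _) (norm_nonneg _) (hb j _)
  have hval : ∀ i j, ∫ ω, (a i (ξ ω) * a j (ξ ω)) * (ε i ω * ε j ω) ∂P =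
      (∫ ω, a i (ξ ω) * a j (ξ ω) ∂P) * ∫ ω, ε i ω * ε j ω ∂P := fun i j =>
    hind.integral_fun_comp_mul_comp (f := fun z => a i z * a j z) (g := fun e => e i * e j)
      hξ.aemeasurable (measurable_pi_lambda _ hε).aemeasurable
      ((ha i).mul (ha j)).aestronglyMeasurable
      ((measurable_pi_apply i).mul (measurable_pi_apply j)).aestronglyMeasurable
  simp_rw [hexp]
  rw [integral_finsetSum _ fun i _ => integrable_finsetSum _ fun j _ => hint i j, Finset.mul_sum]
  refine Finset.sum_congr rfl fun i hi => ?_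
  rw [integral_finsetSum _ fun j _ => hint i j, Finset.sum_eq_single_of_mem i hi fun j _ hj => by
    rw [hval, hcov i j hj.symm, mul_zero], hval, mul_comm]
  simp_rw [← sq]
  rw [hvar]

end noise

/-! ### Second order Taylor expansion -/

/-- Taylor's theorem of order two in several variables, with Peano's form of the remainder. -/
theorem ContDiffAt.taylor_two_isLittleO {E : Type*} [NormedAddCommGroup E] [NormedSpace ℝ E]
    {f : E → ℝ} {x : E} (hf : ContDiffAt ℝ 2 f x) :
    (fun h => f (x + h) - f x - fderiv ℝ f x h - 1 / 2 * fderiv ℝ (fderiv ℝ f) x h h)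
      =o[𝓝 0] fun h => ‖h‖ ^ 2 := by
  have hdiff : ∀ᶠ z in 𝓝 x, DifferentiableAt ℝ f z :=
    (hf.eventually (by simp)).mono fun z hz => hz.differentiableAt (by norm_num)
  have hd2 : HasFDerivAt (fderiv ℝ f) (fderiv ℝ (fderiv ℝ f) x) x :=
    ((hf.fderiv_right (m := 1) (by norm_num)).differentiableAt (by norm_num)).hasFDerivAt
  have hsymm : IsSymmSndFDerivAt ℝ f x := hf.isSymmSndFDerivAt (by simp)
  set B := fderiv ℝ (fderiv ℝ f) x with hB
  have htr : Tendsto (fun h : E => x + h) (𝓝 0) (𝓝 x) := by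
    have : Continuous fun h : E => x + h := by fun_prop
    simpa using this.tendsto 0
  rw [isLittleO_iff]
  intro c hc
  have h1 := (hasFDerivAt_iff_isLittleO_nhds_zero.1 hd2).bound hc
  obtain ⟨r, hr, hball⟩ := Metric.eventually_nhds_iff_ball.1 (h1.and (htr.eventually hdiff))
  filter_upwards [Metric.ball_mem_nhds (0 : E) hr] with h hh
  set g : E → ℝ := fun k => f (x + k) - f x - fderiv ℝ f x k - 1 / 2 * B k k with hg
  have hderiv : ∀ k ∈ Metric.closedBall (0 : E) ‖h‖,
      HasFDerivWithinAt g (fderiv ℝ f (x + k) - fderiv ℝ f x - B k)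
        (Metric.closedBall (0 : E) ‖h‖) k := by
    intro k hk
    have hkr : k ∈ Metric.ball (0 : E) r := by
      rw [mem_closedBall_zero_iff] at hk
      rw [mem_ball_zero_iff] at hh ⊢
      exact hk.trans_lt hh
    have e1 : HasFDerivAt (fun k => f (x + k)) (fderiv ℝ f (x + k)) k :=
      (hasFDerivAt_comp_add_left x).2 (hball k hkr).2.hasFDerivAt
    have e2 : HasFDerivAt (fun k => fderiv ℝ f x k) (fderiv ℝ f x) k :=
      (fderiv ℝ f x).hasFDerivAt
    have e3 : HasFDerivAt (fun k => B k k) (B k + B.flip k) k := by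
      have := B.hasFDerivAt (x := k) |>.clm_apply (hasFDerivAt_id k)
      refine this.congr_fderiv ?_
      ext v
      simp
    refine (((e1.sub_const (f x)).sub e2).sub (e3.const_mul (1 / 2))).congr_fderiv ?_
      |>.hasFDerivWithinAt
    ext v
    have hs : B v k = B k v := hsymm v k
    simp [hs]
    ring
  have hbound : ∀ k ∈ Metric.closedBall (0 : E) ‖h‖,
      ‖fderiv ℝ f (x + k) - fderiv ℝ f x - B k‖ ≤ c * ‖h‖ := by
    intro k hk
    rw [mem_closedBall_zero_iff] at hk
    have hkr : k ∈ Metric.ball (0 : E) r := by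
      rw [mem_ball_zero_iff] at hh ⊢
      exact hk.trans_lt hh
    exact (hball k hkr).1.trans (by gcongr)
  have := (convex_closedBall (0 : E) ‖h‖).norm_image_sub_le_of_norm_hasFDerivWithin_le hderiv hbound
    (Metric.mem_closedBall_self (norm_nonneg h)) (mem_closedBall_zero_iff.2 le_rfl)
  simp only [hg, sub_zero, map_zero, mul_zero, add_zero, sub_self] at this
  rw [Real.norm_of_nonneg (sq_nonneg ‖h‖), sq, ← mul_assoc]
  exact this

/-! ### Radial weights kill linear forms and average quadratic forms -/

section radial

variable {d : ℕ} (g : ℝ → ℝ)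

theorem integral_coord_mul_radial (i : Fin d) :
    ∫ h : EuclideanSpace ℝ (Fin d), h i * g ‖h‖ = 0 := by
  have h1 := integral_neg_eq_self (fun h : EuclideanSpace ℝ (Fin d) => h i * g ‖h‖) volume
  simp only [PiLp.neg_apply, norm_neg, neg_mul, integral_neg] at h1
  linarith

theorem integral_coord_mul_coord_mul_radial {i j : Fin d} (hij : i ≠ j) :
    ∫ h : EuclideanSpace ℝ (Fin d), h i * h j * g ‖h‖ = 0 := by
  -- the reflection of the `i`-th coordinate changes the sign of the integrand
  let e : EuclideanSpace ℝ (Fin d) ≃ₗᵢ[ℝ] EuclideanSpace ℝ (Fin d) :=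
    LinearIsometryEquiv.piLpCongrRight 2
      fun k => if k = i then LinearIsometryEquiv.neg ℝ else LinearIsometryEquiv.refl ℝ ℝ
  have h1 := e.measurePreserving.integral_comp e.toHomeomorph.measurableEmbedding
    (fun h : EuclideanSpace ℝ (Fin d) => h i * h j * g ‖h‖)
  have hi : ∀ h, e h i = - h i := fun h => by simp [e]
  have hj : ∀ h, e h j = h j := fun h => by simp [e, hij.symm]
  simp only [hi, hj, e.norm_map, neg_mul, integral_neg] at h1
  linarith

theorem integral_coord_sq_mul_radial (i j : Fin d) :
    ∫ h : EuclideanSpace ℝ (Fin d), h i * h i * g ‖h‖ =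
      ∫ h : EuclideanSpace ℝ (Fin d), h j * h j * g ‖h‖ := by
  let e : EuclideanSpace ℝ (Fin d) ≃ₗᵢ[ℝ] EuclideanSpace ℝ (Fin d) :=
    LinearIsometryEquiv.piLpCongrLeft 2 ℝ ℝ (Equiv.swap i j)
  have h1 := e.measurePreserving.integral_comp e.toHomeomorph.measurableEmbedding
    (fun h : EuclideanSpace ℝ (Fin d) => h i * h i * g ‖h‖)
  have hi : ∀ h, e h i = h j := fun h => by
    simp [e, LinearIsometryEquiv.piLpCongrLeft_apply, Equiv.piCongrLeft']
  simp only [hi, e.norm_map] at h1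
  exact h1.symm

/-- Against a radial weight, a linear form integrates to zero and a quadratic form has the same
integral as the multiple of `‖h‖ ^ 2` with the same trace. -/
theorem integral_linear_add_quadratic_mul_radial (hd : 0 < d)
    (hint : Integrable fun h : EuclideanSpace ℝ (Fin d) => ‖h‖ * g ‖h‖)
    (hint2 : Integrable fun h : EuclideanSpace ℝ (Fin d) => ‖h‖ ^ 2 * g ‖h‖)
    (L : EuclideanSpace ℝ (Fin d) →L[ℝ] ℝ)
    (B : EuclideanSpace ℝ (Fin d) →L[ℝ] EuclideanSpace ℝ (Fin d) →L[ℝ] ℝ) :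
    ∫ h, (L h + B h h - (∑ i, B (EuclideanSpace.basisFun (Fin d) ℝ i)
      (EuclideanSpace.basisFun (Fin d) ℝ i)) / d * ‖h‖ ^ 2) * g ‖h‖ = 0 := by
  set b := EuclideanSpace.basisFun (Fin d) ℝ with hb
  have hrep : ∀ h : EuclideanSpace ℝ (Fin d), h = ∑ i, h i • b i := fun h => by
    simpa [hb] using (b.sum_repr h).symm
  have hL : ∀ h, L h = ∑ i, h i * L (b i) := fun h => by
    conv_lhs => rw [hrep h]
    simp
  have hB : ∀ h, B h h = ∑ i, ∑ j, h i * h j * B (b i) (b j) := fun h => by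
    conv_lhs => rw [hrep h]
    simp only [map_sum, map_smul, sum_apply, smul_apply,
      smul_eq_mul, Finset.mul_sum]
    rw [Finset.sum_comm]
    exact Finset.sum_congr rfl fun i _ => Finset.sum_congr rfl fun j _ => by ring
  have hN : ∀ h : EuclideanSpace ℝ (Fin d), ‖h‖ ^ 2 = ∑ i, h i * h i := fun h => by
    rw [EuclideanSpace.real_norm_sq_eq]
    exact Finset.sum_congr rfl fun i _ => by ring
  have hcoord : ∀ (h : EuclideanSpace ℝ (Fin d)) i, |h i| ≤ ‖h‖ := fun h i =>
    PiLp.norm_apply_le h i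
  have hgm : AEStronglyMeasurable (fun h : EuclideanSpace ℝ (Fin d) => g ‖h‖) := by
    have h1 : (fun h : EuclideanSpace ℝ (Fin d) => g ‖h‖) =ᵐ[volume]
        fun h => ‖h‖⁻¹ * (‖h‖ * g ‖h‖) := by
      have : Nonempty (Fin d) := ⟨⟨0, hd⟩⟩
      have h0 : ∀ᵐ h : EuclideanSpace ℝ (Fin d), h ≠ 0 := by
        rw [ae_iff]; simp
      filter_upwards [h0] with h hh
      rw [inv_mul_cancel_left₀ (norm_ne_zero_iff.2 hh)]
    exact (AEStronglyMeasurable.mul (by fun_prop) hint.aestronglyMeasurable).congr h1.symm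
  have hi1 : ∀ i, Integrable fun h : EuclideanSpace ℝ (Fin d) => h i * g ‖h‖ := fun i => by
    refine hint.mono (AEStronglyMeasurable.mul (by fun_prop) hgm) (ae_of_all _ fun h => ?_)
    rw [norm_mul, norm_mul, norm_norm]
    gcongr
    exact hcoord h i
  have hi2 : ∀ i j, Integrable fun h : EuclideanSpace ℝ (Fin d) => h i * h j * g ‖h‖ := by
    intro i j
    refine hint2.mono (AEStronglyMeasurable.mul (by fun_prop) hgm) (ae_of_all _ fun h => ?_)
    rw [norm_mul, norm_mul, norm_mul, norm_pow, norm_norm, sq]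
    gcongr
    exacts [hcoord h i, hcoord h j]
  have hexp : ∀ h : EuclideanSpace ℝ (Fin d),
      (L h + B h h - (∑ i, B (b i) (b i)) / d * ‖h‖ ^ 2) * g ‖h‖ =
      (∑ i, L (b i) * (h i * g ‖h‖) + ∑ i, ∑ j, B (b i) (b j) * (h i * h j * g ‖h‖)) -
        (∑ i, B (b i) (b i)) / d * ∑ i, h i * h i * g ‖h‖ := by
    intro h
    rw [hL, hB, hN, sub_mul, add_mul, Finset.sum_mul, Finset.sum_mul, mul_assoc, Finset.sum_mul]
    congr 2
    · exact Finset.sum_congr rfl fun i _ => by ring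
    · refine Finset.sum_congr rfl fun i _ => ?_
      rw [Finset.sum_mul]
      exact Finset.sum_congr rfl fun j _ => by ring
  simp_rw [hexp]
  have j1 : Integrable fun h : EuclideanSpace ℝ (Fin d) => ∑ i, L (b i) * (h i * g ‖h‖) :=
    integrable_finsetSum _ fun i _ => (hi1 i).const_mul _
  have j2' : ∀ i, Integrable fun h : EuclideanSpace ℝ (Fin d) =>
      ∑ j, B (b i) (b j) * (h i * h j * g ‖h‖) := fun i =>
    integrable_finsetSum _ fun j _ => (hi2 i j).const_mul _
  have j2 : Integrable fun h : EuclideanSpace ℝ (Fin d) =>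
      ∑ i, ∑ j, B (b i) (b j) * (h i * h j * g ‖h‖) := integrable_finsetSum _ fun i _ => j2' i
  have j3 : Integrable fun h : EuclideanSpace ℝ (Fin d) => ∑ i, h i * h i * g ‖h‖ :=
    integrable_finsetSum _ fun i _ => hi2 i i
  have j12 : Integrable fun h : EuclideanSpace ℝ (Fin d) => ∑ i, L (b i) * (h i * g ‖h‖) +
      ∑ i, ∑ j, B (b i) (b j) * (h i * h j * g ‖h‖) := j1.add j2
  rw [integral_sub j12 (j3.const_mul _), integral_add j1 j2, integral_const_mul,
    integral_finsetSum _ fun i _ => (hi1 i).const_mul _, integral_finsetSum _ fun i _ => j2' i,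
    integral_finsetSum _ fun i _ => hi2 i i]
  have k1 : ∀ i, ∫ h : EuclideanSpace ℝ (Fin d), L (b i) * (h i * g ‖h‖) = 0 := fun i => by
    rw [integral_const_mul, integral_coord_mul_radial, mul_zero]
  set I : ℝ := ∫ h : EuclideanSpace ℝ (Fin d), h ⟨0, hd⟩ * h ⟨0, hd⟩ * g ‖h‖ with hI
  have k3 : ∀ i, ∫ h : EuclideanSpace ℝ (Fin d), h i * h i * g ‖h‖ = I := fun i =>
    integral_coord_sq_mul_radial g i _
  have k2 : ∀ i, ∫ h : EuclideanSpace ℝ (Fin d), ∑ j, B (b i) (b j) * (h i * h j * g ‖h‖) =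
      B (b i) (b i) * I := fun i => by
    rw [integral_finsetSum _ fun j _ => (hi2 i j).const_mul _, Finset.sum_eq_single_of_mem i
      (Finset.mem_univ i) fun j _ hj => by
        rw [integral_const_mul, integral_coord_mul_coord_mul_radial g hj.symm, mul_zero],
      integral_const_mul, k3]
  simp only [k1, k2, k3, Finset.sum_const_zero, zero_add, Finset.sum_const, Finset.card_univ,
    Fintype.card_fin, nsmul_eq_mul, ← Finset.sum_mul]
  have : (d : ℝ) ≠ 0 := by positivity
  field_simp
  ring

end radial

/-! ### Small balls -/

section smallBalls

variable {d : ℕ}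

theorem unitBallVolume_pos (d : ℕ) : 0 < unitBallVolume d :=
  div_pos (Real.rpow_pos_of_pos Real.pi_pos _) (Real.Gamma_pos_of_pos (by positivity))

theorem volume_real_closedBall (hd : 0 < d) (x : EuclideanSpace ℝ (Fin d)) {r : ℝ} (hr : 0 ≤ r) :
    (volume : Measure (EuclideanSpace ℝ (Fin d))).real (Metric.closedBall x r) =
      r ^ d * unitBallVolume d := by
  have : Nonempty (Fin d) := ⟨⟨0, hd⟩⟩
  rw [Measure.real, EuclideanSpace.volume_closedBall, Fintype.card_fin, ENNReal.toReal_mul,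
    ENNReal.toReal_pow, ENNReal.toReal_ofReal hr, ENNReal.toReal_ofReal, unitBallVolume,
    Real.sqrt_eq_rpow, ← Real.rpow_natCast (Real.pi ^ (1 / 2 : ℝ)), ← Real.rpow_mul Real.pi_pos.le,
    add_comm]
  · congr 3; ring
  · have := Real.Gamma_pos_of_pos (show (0 : ℝ) < d / 2 + 1 by positivity)
    positivity

variable {f : EuclideanSpace ℝ (Fin d) → ℝ} {x : EuclideanSpace ℝ (Fin d)}
  {ν : Measure (EuclideanSpace ℝ (Fin d))}

theorem sphere_null_of_withDensity (hd : 0 < d)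
    (hdens : ν = volume.withDensity fun z => ENNReal.ofReal (f z)) (r : ℝ) :
    ν {w | dist w x = r} = 0 := by
  have : Nonempty (Fin d) := ⟨⟨0, hd⟩⟩
  rw [hdens]
  exact withDensity_absolutelyContinuous _ _ (Measure.addHaar_sphere volume x r)

/-- The mass of a small ball is that of the constant density `f x`, to first order. -/
theorem tendsto_one_sub_tailProb_div [IsProbabilityMeasure ν] (hd : 0 < d) (hf : Measurable f)
    (hf0 : ∀ z, 0 ≤ f z)
    (hdens : ν = volume.withDensity fun z => ENNReal.ofReal (f z)) (hfc : ContinuousAt f x) :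
    Tendsto (fun z => (1 - tailProb ν x z) / dist z x ^ d) (𝓝[≠] x)
      (𝓝 (unitBallVolume d * f x)) := by
  have hV := unitBallVolume_pos d
  rw [Metric.tendsto_nhds]
  intro η hη
  obtain ⟨r, hr, hball⟩ := Metric.continuousAt_iff.1 hfc (η / (2 * unitBallVolume d))
    (by positivity)
  filter_upwards [inter_mem_nhdsWithin _ (Metric.ball_mem_nhds x hr)] with z hz
  obtain ⟨hzx, hzr⟩ := hz
  have hρ : 0 < dist z x := dist_pos.2 hzx
  set ρ := dist z x with hρdef
  have hfin : IntegrableOn f (Metric.closedBall x ρ) volume := by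
    refine Measure.integrableOn_of_bounded (M := |f x| + η / (2 * unitBallVolume d))
      (measure_closedBall_lt_top.ne) hf.aestronglyMeasurable ?_
    filter_upwards [ae_restrict_mem Metric.isClosed_closedBall.measurableSet] with w hw
    have := hball (lt_of_le_of_lt (Metric.mem_closedBall.1 hw) hzr)
    rw [Real.dist_eq] at this
    rw [Real.norm_eq_abs]
    have := abs_sub_abs_le_abs_sub (f w) (f x)
    linarith
  have hmass : 1 - tailProb ν x z = ∫ w in Metric.closedBall x ρ, f w := by
    rw [one_sub_tailProb, integral_eq_lintegral_of_nonneg_ae (ae_of_all _ hf0)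
      hf.aestronglyMeasurable, Measure.real, hdens,
      ← withDensity_apply _ Metric.isClosed_closedBall.measurableSet]
    rfl
  have hvol := volume_real_closedBall hd x hρ.le
  have hest : ‖∫ w in Metric.closedBall x ρ, (f w - f x)‖ ≤
      η / (2 * unitBallVolume d) * (ρ ^ d * unitBallVolume d) := by
    rw [← hvol]
    refine norm_setIntegral_le_of_norm_le_const measure_closedBall_lt_top fun w hw => ?_
    exact (hball (lt_of_le_of_lt (Metric.mem_closedBall.1 hw) hzr)).le
  rw [integral_sub hfin (integrableOn_const measure_closedBall_lt_top.ne), ← hmass,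
    setIntegral_const, hvol, smul_eq_mul, Real.norm_eq_abs] at hest
  have hρd : 0 < ρ ^ d := by positivity
  rw [Real.dist_eq, show (1 - tailProb ν x z) / ρ ^ d - unitBallVolume d * f x =
    ((1 - tailProb ν x z) - ρ ^ d * unitBallVolume d * f x) / ρ ^ d by field_simp, abs_div,
    abs_of_pos hρd, div_lt_iff₀ hρd]
  refine hest.trans_lt ?_
  rw [show η / (2 * unitBallVolume d) * (ρ ^ d * unitBallVolume d) = η / 2 * ρ ^ d by field_simp]
  nlinarith

/-- The squared distance to `x` in terms of the uniform variable `1 - tailProb ν x`. -/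
theorem dist_sq_sub_isLittleO [IsProbabilityMeasure ν] (hd : 0 < d) (hf : Measurable f)
    (hf0 : ∀ z, 0 ≤ f z)
    (hdens : ν = volume.withDensity fun z => ENNReal.ofReal (f z)) (hfc : ContinuousAt f x)
    (hfx : 0 < f x) :
    (fun z => dist z x ^ 2 - (unitBallVolume d * f x) ^ (-(2 / (d : ℝ))) *
      (1 - tailProb ν x z) ^ (2 / (d : ℝ))) =o[𝓝 x]
      fun z => (1 - tailProb ν x z) ^ (2 / (d : ℝ)) := by
  have hV := mul_pos (unitBallVolume_pos d) hfx
  have hdpos : (0 : ℝ) < d := by exact_mod_cast hd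
  have ha : 0 < 2 / (d : ℝ) := by positivity
  have h0 := tendsto_one_sub_tailProb_div hd hf hf0 hdens hfc
  have h1 := h0.rpow_const (p := -(2 / (d : ℝ))) (Or.inl hV.ne')
  have hne : ∀ᶠ z in 𝓝[≠] x, (fun z => ((1 - tailProb ν x z) / dist z x ^ d) ^ (-(2 / (d : ℝ)))) z =
      dist z x ^ 2 / (1 - tailProb ν x z) ^ (2 / (d : ℝ)) ∧
        0 < (1 - tailProb ν x z) ^ (2 / (d : ℝ)) := by
    filter_upwards [h0.eventually (lt_mem_nhds hV), self_mem_nhdsWithin] with z hz hzx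
    have hρ : 0 < dist z x := dist_pos.2 hzx
    have hU : 0 < 1 - tailProb ν x z := (div_pos_iff_of_pos_right (by positivity)).1 hz
    refine ⟨?_, Real.rpow_pos_of_pos hU _⟩
    rw [Real.rpow_neg (by positivity), Real.div_rpow hU.le (by positivity), inv_div,
      ← Real.rpow_natCast, ← Real.rpow_mul hρ.le, mul_div_cancel₀ _ hdpos.ne']
    norm_num
  have h2 : Tendsto (fun z => dist z x ^ 2 / (1 - tailProb ν x z) ^ (2 / (d : ℝ))) (𝓝[≠] x)
      (𝓝 ((unitBallVolume d * f x) ^ (-(2 / (d : ℝ))))) :=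
    h1.congr' (hne.mono fun z hz => hz.1)
  have h3 : (fun z => dist z x ^ 2 - (unitBallVolume d * f x) ^ (-(2 / (d : ℝ))) *
      (1 - tailProb ν x z) ^ (2 / (d : ℝ))) =o[𝓝[≠] x]
      fun z => (1 - tailProb ν x z) ^ (2 / (d : ℝ)) := by
    have h4 := h2.sub_const ((unitBallVolume d * f x) ^ (-(2 / (d : ℝ))))
    rw [sub_self] at h4
    refine (((isLittleO_one_iff ℝ).2 h4).mul_isBigO (isBigO_refl
      (fun z => (1 - tailProb ν x z) ^ (2 / (d : ℝ))) _)).congr' ?_ (by simp)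
    filter_upwards [hne] with z hz
    have := hz.2.ne'
    field_simp
  -- at `x` itself both sides vanish, because `tailProb ν x x = 1`
  rw [← nhdsNE_sup_pure]
  refine h3.sup ?_
  rw [isLittleO_pure]
  have : tailProb ν x x = 1 := by
    have h := one_sub_tailProb ν x x
    rw [Measure.real, show {w | dist w x ≤ dist x x} = {w | dist w x = 0} by ext; simp,
      sphere_null_of_withDensity hd hdens, ENNReal.toReal_zero] at h
    linarith
  simp [this, Real.zero_rpow ha.ne']

end smallBalls

/-! ### The expansion of the bias -/

section bias

variable {d : ℕ} {f μ : EuclideanSpace ℝ (Fin d) → ℝ} {x : EuclideanSpace ℝ (Fin d)}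
  {ν : Measure (EuclideanSpace ℝ (Fin d))}

/-- A continuous density that is almost surely bounded below is positive at points of the
support. -/
theorem density_pos_of_mem_support (hfc : ContinuousAt f x) (hx : x ∈ ν.support) {c : ℝ}
    (hc : 0 < c) (hfbdd : ∀ᵐ z ∂ν, c ≤ f z) : 0 < f x := by
  refine hc.trans_le (not_lt.1 fun hlt => ?_)
  have h1 : {z | f z < c} ∈ 𝓝 x := hfc.eventually (gt_mem_nhds hlt)
  refine ((Measure.mem_support_iff_forall x).1 hx _ h1).ne' ?_
  simpa [ae_iff] using hfbdd

/-- The quadratic form of the second order expansion of `(μ - μ x) * f` at `x`. -/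
noncomputable def expansionForm (f μ : EuclideanSpace ℝ (Fin d) → ℝ)
    (x : EuclideanSpace ℝ (Fin d)) :
    EuclideanSpace ℝ (Fin d) →L[ℝ] EuclideanSpace ℝ (Fin d) →L[ℝ] ℝ :=
  (f x / 2) • fderiv ℝ (fderiv ℝ μ) x + (fderiv ℝ μ x).smulRight (fderiv ℝ f x)

theorem sum_expansionForm :
    ∑ i, expansionForm f μ x (EuclideanSpace.basisFun (Fin d) ℝ i)
      (EuclideanSpace.basisFun (Fin d) ℝ i) =
    (f x * Laplacian.laplacian μ x + 2 * inner ℝ (gradient μ x) (gradient f x)) / 2 := by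
  set b := EuclideanSpace.basisFun (Fin d) ℝ with hb
  have hgrad : ∀ (g : EuclideanSpace ℝ (Fin d) → ℝ) v, inner ℝ (gradient g x) v = fderiv ℝ g x v :=
    fun g v => by rw [gradient, InnerProductSpace.toDual_symm_apply]
  have h1 : inner ℝ (gradient μ x) (gradient f x) =
      ∑ i, fderiv ℝ μ x (b i) * fderiv ℝ f x (b i) := by
    rw [← b.sum_inner_mul_inner]
    refine Finset.sum_congr rfl fun i _ => ?_
    rw [hgrad, real_inner_comm, hgrad]
  have h2 : Laplacian.laplacian μ x = ∑ i, fderiv ℝ (fderiv ℝ μ) x (b i) (b i) := by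
    rw [InnerProductSpace.laplacian_eq_iteratedFDeriv_orthonormalBasis μ b]
    simp [iteratedFDeriv_two_apply]
  rw [h1, h2]
  simp only [expansionForm, add_apply, smul_apply, ContinuousLinearMap.smulRight_apply, smul_eq_mul,
    Finset.sum_add_distrib, ← Finset.mul_sum]
  ring

theorem sub_mul_sub_expansion_isLittleO (hf2 : ContDiffAt ℝ 2 f x) (hμ2 : ContDiffAt ℝ 2 μ x) :
    (fun h => (μ (x + h) - μ x) * f (x + h) - (f x • fderiv ℝ μ x) h - expansionForm f μ x h h)
      =o[𝓝 0] fun h => ‖h‖ ^ 2 := by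
  have ht := hμ2.taylor_two_isLittleO
  have hdf := hasFDerivAt_iff_isLittleO_nhds_zero.1
    (hf2.differentiableAt (by norm_num)).hasFDerivAt
  have hdμ := hasFDerivAt_iff_isLittleO_nhds_zero.1
    (hμ2.differentiableAt (by norm_num)).hasFDerivAt
  have hLf : (fun h => fderiv ℝ f x h) =O[𝓝 0] fun h => h := (fderiv ℝ f x).isBigO_id _
  have hLμ : (fun h => fderiv ℝ μ x h) =O[𝓝 0] fun h => h := (fderiv ℝ μ x).isBigO_id _
  have hμO : (fun h => μ (x + h) - μ x) =O[𝓝 0] fun h => h :=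
    (hdμ.isBigO.add hLμ).congr_left fun h => by ring
  have h1 : (fun h => (μ (x + h) - μ x) * (f (x + h) - f x - fderiv ℝ f x h)) =o[𝓝 0]
      fun h => ‖h‖ ^ 2 := by
    simpa only [← sq] using hμO.norm_right.mul_isLittleO hdf.norm_right
  have h2 : (fun h => fderiv ℝ f x h * (μ (x + h) - μ x - fderiv ℝ μ x h)) =o[𝓝 0]
      fun h => ‖h‖ ^ 2 := by
    simpa only [← sq] using hLf.norm_right.mul_isLittleO hdμ.norm_right
  refine ((h1.add h2).add (ht.const_mul_left (f x))).congr_left fun h => ?_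
  simp only [expansionForm, add_apply, smul_apply, ContinuousLinearMap.smulRight_apply, smul_eq_mul]
  ring

/-- The expected value of `μ` at the nearest neighbour among `s` points. The expansion of
`(μ - μ x) * f` at `x` is split into a part that integrates to zero for reasons of symmetry and a
multiple of the squared distance, for which the uniform variable `1 - tailProb ν x` gives the
asymptotics. -/
theorem bias_sub_isLittleO [IsProbabilityMeasure ν] (hd : 0 < d) (hf : Measurable f)
    (hf0 : ∀ z, 0 ≤ f z) (hdens : ν = volume.withDensity fun z => ENNReal.ofReal (f z)) {c : ℝ}
    (hc : 0 < c) (hfbdd : ∀ᵐ z ∂ν, c ≤ f z) (hx : x ∈ ν.support) (hf2 : ContDiffAt ℝ 2 f x)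
    (hμ2 : ContDiffAt ℝ 2 μ x) (hμint : Integrable μ ν) :
    (fun s : ℕ => ((s : ℝ) * ∫ z, μ z * tailProb ν x z ^ (s - 1) ∂ν - μ x) -
      biasCoeff f μ x * (s : ℝ) ^ (-2 / (d : ℝ)))
      =o[atTop] fun s : ℕ => (s : ℝ) ^ (-2 / (d : ℝ)) := by
  have hdpos : (0 : ℝ) < d := by exact_mod_cast hd
  have hν := sphere_null_of_withDensity (x := x) hd hdens
  have hfc : ContinuousAt f x := hf2.continuousAt
  have hfx : 0 < f x := density_pos_of_mem_support hfc hx hc hfbdd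
  have hV := unitBallVolume_pos d
  obtain ⟨r, hr, hball⟩ := Metric.eventually_nhds_iff_ball.1
    (hfc.eventually (lt_mem_nhds (half_lt_self hfx)))
  set L := f x • fderiv ℝ μ x with hL
  set B := expansionForm f μ x with hB
  set t : ℝ := (∑ i, B (EuclideanSpace.basisFun (Fin d) ℝ i)
      (EuclideanSpace.basisFun (Fin d) ℝ i)) / d with ht
  -- the part of the expansion that is orthogonal to radial functions
  let D : EuclideanSpace ℝ (Fin d) → ℝ := fun h => L h + B h h - t * ‖h‖ ^ 2
  have hDc : Continuous D := by fun_prop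
  let ψ : EuclideanSpace ℝ (Fin d) → ℝ :=
    (Metric.ball x r).indicator fun z => D (z - x) / f z
  have hψin : ∀ z ∈ Metric.ball x r, ψ z = D (z - x) / f z := fun z hz =>
    Set.indicator_of_mem hz _
  have hψout : ∀ z ∉ Metric.ball x r, ψ z = 0 := fun z hz => Set.indicator_of_notMem hz _
  have hψm : Measurable ψ :=
    (((hDc.comp (continuous_id.sub continuous_const)).measurable).div hf).indicator
      measurableSet_ball
  have hDb : ∃ K, ∀ h ∈ Metric.closedBall (0 : EuclideanSpace ℝ (Fin d)) r, ‖D h‖ ≤ K :=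
    (isCompact_closedBall 0 r).exists_bound_of_continuousOn hDc.continuousOn
  obtain ⟨K, hK⟩ := hDb
  have hψint : Integrable ψ ν := by
    refine Integrable.of_bound (C := K / (f x / 2)) hψm.aestronglyMeasurable
      (ae_of_all _ fun z => ?_)
    have hK0 : 0 ≤ K := (norm_nonneg _).trans (hK 0 (Metric.mem_closedBall_self hr.le))
    by_cases hz : z ∈ Metric.ball x r
    · rw [hψin z hz, norm_div]
      have h1 := hball z hz
      have h2 : ‖D (z - x)‖ ≤ K := hK _ (by
        rw [mem_closedBall_zero_iff, ← dist_eq_norm]; exact (Metric.mem_ball.1 hz).le)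
      rw [Real.norm_of_nonneg (hf0 z)]
      gcongr
    · rw [hψout z hz, norm_zero]; positivity
  have hψzero : ∀ m : ℕ, ∫ z, ψ z * tailProb ν x z ^ m ∂ν = 0 := by
    intro m
    let g : ℝ → ℝ := fun ρ => if ρ < r then (ν.real {w | ρ < dist w x}) ^ m else 0
    have hgb : ∀ h : EuclideanSpace ℝ (Fin d), ‖g ‖h‖‖ ≤ 1 := by
      intro h
      simp only [g]
      split_ifs
      · rw [Real.norm_of_nonneg (by positivity)]
        exact pow_le_one₀ measureReal_nonneg measureReal_le_one
      · simp
    have hgm : Measurable fun h : EuclideanSpace ℝ (Fin d) => g ‖h‖ := by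
      have h1 : Measurable fun ρ : ℝ => ν.real {w | ρ < dist w x} :=
        Antitone.measurable fun a b hab =>
          measureReal_mono fun w hw => lt_of_le_of_lt hab hw
      exact (Measurable.ite measurableSet_Iio (h1.pow_const m) measurable_const).comp
        measurable_norm
    have hgint : ∀ k : ℕ, Integrable fun h : EuclideanSpace ℝ (Fin d) => ‖h‖ ^ k * g ‖h‖ := by
      intro k
      have h1 : Integrable ((Metric.ball (0 : EuclideanSpace ℝ (Fin d)) r).indicator
          fun _ => r ^ k) := (integrable_indicator_iff measurableSet_ball).2
        (integrableOn_const measure_ball_lt_top.ne)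
      refine h1.mono' ((by fun_prop : AEStronglyMeasurable
        (fun h : EuclideanSpace ℝ (Fin d) => ‖h‖ ^ k) volume).mul hgm.aestronglyMeasurable)
        (ae_of_all _ fun h => ?_)
      by_cases hh : ‖h‖ < r
      · rw [Set.indicator_of_mem (mem_ball_zero_iff.2 hh), norm_mul, norm_pow, norm_norm]
        calc ‖h‖ ^ k * ‖g ‖h‖‖ ≤ r ^ k * 1 := by gcongr; exact hgb h
          _ = r ^ k := mul_one _
      · rw [Set.indicator_of_notMem (fun h' => hh (mem_ball_zero_iff.1 h'))]
        simp [g, hh]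
    have h1 := integral_linear_add_quadratic_mul_radial g hd (by simpa using hgint 1) (hgint 2) L B
    rw [← ht, ← integral_sub_right_eq_self _ x] at h1
    rw [← h1]
    conv_lhs => rw [hdens]
    rw [integral_withDensity_eq_integral_toReal_smul (by fun_prop)
      (ae_of_all _ fun _ => ENNReal.ofReal_lt_top)]
    refine integral_congr_ae (ae_of_all _ fun z => ?_)
    simp only [ENNReal.toReal_ofReal (hf0 z), smul_eq_mul]
    by_cases hz : z ∈ Metric.ball x r
    · have h2 : f z ≠ 0 := (lt_trans (half_pos hfx) (hball z hz)).ne'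
      have h3 : dist z x < r := hz
      have h4 : g ‖z - x‖ = tailProb ν x z ^ m := by
        simp only [g, ← dist_eq_norm, if_pos h3, tailProb]
      rw [h4]
      rw [← hdens, hψin z hz]
      simp only [D]
      field_simp
    · have h3 : ¬ dist z x < r := hz
      have h4 : g ‖z - x‖ = 0 := by
        simp only [g, ← dist_eq_norm, if_neg h3]
      simp [h4, hψout z hz]
  -- near `x` the remaining part is a multiple of the squared distance
  have hrem : (fun z => (μ z - μ x - ψ z) - t / f x * dist z x ^ 2) =o[𝓝 x]
      fun z => dist z x ^ 2 := by
    have htr : Tendsto (fun z => z - x) (𝓝 x) (𝓝 0) := by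
      have : Continuous fun z : EuclideanSpace ℝ (Fin d) => z - x := by fun_prop
      simpa using this.tendsto x
    have h1 := (sub_mul_sub_expansion_isLittleO hf2 hμ2).comp_tendsto htr
    have h2 : (fun z => t / f x * (f x - f z) * dist z x ^ 2) =o[𝓝 x] fun z => dist z x ^ 2 := by
      have h3 : Tendsto (fun z => t / f x * (f x - f z)) (𝓝 x) (𝓝 0) := by
        have := (hfc.tendsto.const_sub (f x)).const_mul (t / f x)
        simpa using this
      simpa using ((isLittleO_one_iff ℝ).2 h3).mul_isBigO
        (isBigO_refl (fun z => dist z x ^ 2) (𝓝 x))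
    have h3 : (fun z => (f z)⁻¹) =O[𝓝 x] fun _ => (1 : ℝ) :=
      (hfc.inv₀ hfx.ne').norm.isBoundedUnder_le.isBigO_one ℝ
    have h1' : (fun z => (μ z - μ x) * f z - L (z - x) - B (z - x) (z - x)) =o[𝓝 x]
        fun z => dist z x ^ 2 :=
      h1.congr (fun z => by simp [hL, hB]) (fun z => by simp [dist_eq_norm])
    have h4 := h3.mul_isLittleO (h1'.add h2)
    simp only [one_mul] at h4
    refine h4.congr' ?_ EventuallyEq.rfl
    filter_upwards [Metric.ball_mem_nhds x hr] with z hz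
    have h5 : f z ≠ 0 := (lt_trans (half_pos hfx) (hball z hz)).ne'
    simp only [hψin z hz, D, dist_eq_norm]
    field_simp
    ring
  have hdist := dist_sq_sub_isLittleO hd hf hf0 hdens hfc hfx
  set κ : ℝ := (unitBallVolume d * f x) ^ (-(2 / (d : ℝ))) with hκ
  have hdistO : (fun z => dist z x ^ 2) =O[𝓝 x]
      fun z => (1 - tailProb ν x z) ^ (2 / (d : ℝ)) :=
    (hdist.isBigO.add ((isBigO_refl (fun z => (1 - tailProb ν x z) ^ (2 / (d : ℝ)))
      (𝓝 x)).const_mul_left κ)).congr_left fun z => by ring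
  have hφ : (fun z => (μ z - μ x - ψ z) - t / f x * κ * (1 - tailProb ν x z) ^ (2 / (d : ℝ)))
      =o[𝓝 x] fun z => (1 - tailProb ν x z) ^ (2 / (d : ℝ)) :=
    ((hrem.trans_isBigO hdistO).add (hdist.const_mul_left (t / f x))).congr_left
      fun z => by ring
  have hint : Integrable (fun z => μ z - μ x - ψ z) ν :=
    (hμint.sub (integrable_const _)).sub hψint
  have hmain := integral_mul_tailProb_pow_sub_isLittleO hν hx (by positivity : 0 ≤ 2 / (d : ℝ))
    hint (t / f x * κ) hφ
  have hcoef : t / f x * κ * Real.Gamma (2 / (d : ℝ) + 1) = biasCoeff f μ x := by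
    rw [ht, hB, sum_expansionForm, biasCoeff, hκ, Real.rpow_neg (by positivity),
      Real.mul_rpow hV.le hfx.le, Real.rpow_add hfx, Real.rpow_one]
    have h1 := (Real.rpow_pos_of_pos hV (2 / (d : ℝ))).ne'
    have h2 := (Real.rpow_pos_of_pos hfx (2 / (d : ℝ))).ne'
    have h3 := hfx.ne'
    field_simp
  rw [hcoef] at hmain
  rw [show -2 / (d : ℝ) = -(2 / (d : ℝ)) by ring]
  refine hmain.congr' ?_ EventuallyEq.rfl
  filter_upwards [eventually_ge_atTop 1] with s hs
  congr 1
  have h1 : ∀ z, (μ z - μ x - ψ z) * tailProb ν x z ^ (s - 1) = (μ z * tailProb ν x z ^ (s - 1) -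
      μ x * tailProb ν x z ^ (s - 1)) - ψ z * tailProb ν x z ^ (s - 1) := fun z => by ring
  simp_rw [h1]
  have i1 := integrable_mul_tailProb_pow (x := x) hμint (s - 1)
  have i2 := (integrable_tailProb_pow (ν := ν) (x := x) (s - 1)).const_mul (μ x)
  have i12 : Integrable (fun z => μ z * tailProb ν x z ^ (s - 1) -
      μ x * tailProb ν x z ^ (s - 1)) ν := i1.sub i2
  rw [integral_sub i12 (integrable_mul_tailProb_pow hψint _), hψzero, sub_zero,
    integral_sub i1 i2, integral_const_mul, integral_tailProb_pow hν, Nat.cast_sub hs]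
  have : (s : ℝ) ≠ 0 := by positivity
  rw [Nat.cast_one, sub_add_cancel, mul_sub]
  congr 1
  field_simp

end bias

/-! ### Second moments of the weights -/

section secondMoments

variable {d : ℕ} {Ω : Type*} [MeasurableSpace Ω] {P : Measure Ω} [IsProbabilityMeasure P]
  {X : ℕ → Ω → EuclideanSpace ℝ (Fin d)} {ν : Measure (EuclideanSpace ℝ (Fin d))}
  {x : EuclideanSpace ℝ (Fin d)}

theorem exists_nnInd_eq (x : EuclideanSpace ℝ (Fin d)) (p : ℕ → EuclideanSpace ℝ (Fin d))
    {S : Finset ℕ} (hS : S.Nonempty) :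
    ∃ i ∈ S, ∀ j, nnInd x p S j = if j = i then 1 else 0 := by
  obtain ⟨i, hi, huniq⟩ := existsUnique_isNearest x (fun j => (p j, 0)) S hS
  refine ⟨i, hi.1, fun j => ?_⟩
  unfold nnInd
  by_cases hj : j = i
  · subst hj; rw [if_pos rfl]; exact if_pos hi
  · rw [if_neg hj]; exact if_neg fun h => hj (huniq j h)

theorem integrable_nnInd_mul_nnInd (hX : ∀ i, Measurable (X i)) (S T : Finset ℕ) (i j : ℕ) :
    Integrable (fun ω => nnInd x (fun k => X k ω) S i * nnInd x (fun k => X k ω) T j) P := by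
  have hm : Measurable fun ω (k : ℕ) => X k ω := measurable_pi_lambda _ hX
  refine Integrable.of_bound (C := 1) (((measurable_nnInd x S i).comp hm).mul
    ((measurable_nnInd x T j).comp hm)).aestronglyMeasurable (ae_of_all _ fun ω => ?_)
  rw [norm_mul]
  exact mul_le_one₀ (abs_nnInd_le_one _ _ _ _) (norm_nonneg _) (abs_nnInd_le_one _ _ _ _)

/-- The covariance of two nearest neighbour indicators given the common feature `X i`. It is
controlled by the number of further labels that the two subsamples share. -/
theorem integral_nnInd_sub_mul_nnInd_sub_le (hX : ∀ i, Measurable (X i)) (hind : iIndepFun X P)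
    (hlaw : ∀ i, P.map (X i) = ν) (hν : ∀ r, ν {w | dist w x = r} = 0) {s i : ℕ}
    {S T : Finset ℕ} (hS : S.card = s) (hT : T.card = s) (hiS : i ∈ S) (hiT : i ∈ T) :
    ∫ ω, (nnInd x (fun k => X k ω) S i - tailProb ν x (X i ω) ^ (s - 1)) *
        (nnInd x (fun k => X k ω) T i - tailProb ν x (X i ω) ^ (s - 1)) ∂P ≤
      (((S ∩ T).card : ℝ) - 1) / (s * (2 * s - 1)) := by
  have : IsProbabilityMeasure ν := hlaw i ▸ Measure.isProbabilityMeasure_map (hX i).aemeasurable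
  have hs : 1 ≤ s := hS ▸ Finset.card_pos.2 ⟨i, hiS⟩
  have hm : Measurable fun ω (k : ℕ) => X k ω := measurable_pi_lambda _ hX
  have hq : ∀ m, Integrable (fun ω => tailProb ν x (X i ω) ^ m) P := fun m =>
    Integrable.comp_measurable (g := fun z => tailProb ν x z ^ m)
      (by rw [hlaw i]; exact integrable_tailProb_pow m) (hX i)
  have hqI : ∀ U : Finset ℕ, Integrable (fun ω => tailProb ν x (X i ω) ^ (s - 1) *
      nnInd x (fun k => X k ω) U i) P := fun U =>
    (hq (s - 1)).mul_bdd (c := 1) ((measurable_nnInd x U i).comp hm).aestronglyMeasurable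
      (ae_of_all _ fun ω => abs_nnInd_le_one _ _ _ _)
  have hqq : ∫ ω, tailProb ν x (X i ω) ^ (2 * (s - 1)) ∂P = 1 / (2 * s - 1) := by
    rw [← integral_map (hX i).aemeasurable (f := fun z => tailProb ν x z ^ (2 * (s - 1)))
      (by rw [hlaw i]; exact (integrable_tailProb_pow _).1), hlaw i, integral_tailProb_pow hν]
    rw [Nat.cast_mul, Nat.cast_sub hs]
    push_cast
    ring_nf
  have hcast : ((s - 1 : ℕ) : ℝ) + s = 2 * s - 1 := by rw [Nat.cast_sub hs]; push_cast; ring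
  have hI := integral_nnInd (x := x) hX hind hlaw hν (Finset.mem_union_left T hiS)
  have hqS := integral_tailProb_pow_mul_nnInd (x := x) hX hind hlaw hν hiS (s - 1)
  have hqT := integral_tailProb_pow_mul_nnInd (x := x) hX hind hlaw hν hiT (s - 1)
  rw [hS, hcast] at hqS
  rw [hT, hcast] at hqT
  have hexp : ∀ ω, (nnInd x (fun k => X k ω) S i - tailProb ν x (X i ω) ^ (s - 1)) *
      (nnInd x (fun k => X k ω) T i - tailProb ν x (X i ω) ^ (s - 1)) =
      nnInd x (fun k => X k ω) S i * nnInd x (fun k => X k ω) T i -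
      (tailProb ν x (X i ω) ^ (s - 1) * nnInd x (fun k => X k ω) S i +
        tailProb ν x (X i ω) ^ (s - 1) * nnInd x (fun k => X k ω) T i -
        tailProb ν x (X i ω) ^ (2 * (s - 1))) := fun ω => by
    rw [mul_comm 2, pow_mul]; ring
  simp_rw [hexp]
  have hI12 : Integrable (fun ω => tailProb ν x (X i ω) ^ (s - 1) * nnInd x (fun k => X k ω) S i +
      tailProb ν x (X i ω) ^ (s - 1) * nnInd x (fun k => X k ω) T i) P := (hqI S).add (hqI T)
  have hI123 : Integrable (fun ω =>
      tailProb ν x (X i ω) ^ (s - 1) * nnInd x (fun k => X k ω) S i +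
        tailProb ν x (X i ω) ^ (s - 1) * nnInd x (fun k => X k ω) T i -
        tailProb ν x (X i ω) ^ (2 * (s - 1))) P := hI12.sub (hq _)
  rw [integral_sub (integrable_nnInd_mul_nnInd hX S T i i) hI123,
    integral_sub hI12 (hq _), integral_add (hqI S) (hqI T), hqS, hqT, hqq]
  simp_rw [nnInd_mul_nnInd x _ hiS hiT]
  rw [hI]
  have hcard : ((S ∪ T).card : ℝ) + ((S ∩ T).card : ℝ) = 2 * s := by
    have := Finset.card_union_add_card_inter S T
    rw [hS, hT] at this
    exact_mod_cast this.trans (two_mul s).symm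
  have hge : (s : ℝ) ≤ (S ∪ T).card := by
    rw [← hS]; exact_mod_cast Finset.card_le_card Finset.subset_union_left
  have hk : (1 : ℝ) ≤ (S ∩ T).card := by
    exact_mod_cast Finset.card_pos.2 ⟨i, Finset.mem_inter.2 ⟨hiS, hiT⟩⟩
  have hs1 : (1 : ℝ) ≤ s := by exact_mod_cast hs
  have hu : (0 : ℝ) < (S ∪ T).card := by linarith
  have h2 : (0 : ℝ) < 2 * s - 1 := by linarith
  calc 1 / ((S ∪ T).card : ℝ) - (1 / (2 * s - 1) + 1 / (2 * s - 1) - 1 / (2 * (s : ℝ) - 1))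
      = (((S ∩ T).card : ℝ) - 1) / ((S ∪ T).card * (2 * s - 1)) := by
        rw [show ((S ∩ T).card : ℝ) = 2 * s - (S ∪ T).card by linarith]
        field_simp
        ring
    _ ≤ _ := by
        gcongr

/-- The weight of the `i`-th response is close to its conditional expectation
`s / n * tailProb ν x (X i) ^ (s - 1)` given the feature `X i`. -/
theorem integral_sq_nnWeight_sub_le (hX : ∀ i, Measurable (X i)) (hind : iIndepFun X P)
    (hlaw : ∀ i, P.map (X i) = ν) (hν : ∀ r, ν {w | dist w x = r} = 0) {n s i : ℕ} (hs : 1 ≤ s)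
    (hsn : s ≤ n) (hn : 2 ≤ n) (hi : i < n) :
    ∫ ω, (nnWeight x (fun k => X k ω) n s i -
        (s : ℝ) / n * tailProb ν x (X i ω) ^ (s - 1)) ^ 2 ∂P ≤
      ((s : ℝ) / n) ^ 2 * ((s : ℝ) / n / (2 * s - 1)) := by
  have : IsProbabilityMeasure ν := hlaw i ▸ Measure.isProbabilityMeasure_map (hX i).aemeasurable
  set 𝓢 := ((Finset.range n).powersetCard s).filter (i ∈ ·) with h𝓢
  set N : ℝ := (n.choose s : ℝ) with hN
  set M : ℝ := ((n - 1).choose (s - 1) : ℝ) with hM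
  have hNpos : 0 < N := Nat.cast_pos.2 (Nat.choose_pos hsn)
  have hnpos : (2 : ℝ) ≤ n := by exact_mod_cast hn
  have hspos : (1 : ℝ) ≤ s := by exact_mod_cast hs
  have hsn' : (s : ℝ) ≤ n := by exact_mod_cast hsn
  have hcard : (𝓢.card : ℝ) = M := by
    have h1 := card_filter_subset_powersetCard (A := {i}) (R := Finset.range n) (s := s)
      (by simpa using hi) (by simpa using hs)
    simp only [Finset.singleton_subset_iff, Finset.card_singleton, Finset.card_range] at h1
    rw [h𝓢, h1]
  have hNM : (n : ℝ) * M = s * N := by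
    obtain ⟨a, rfl⟩ := Nat.exists_eq_add_of_le' hs
    obtain ⟨b, rfl⟩ := Nat.exists_eq_add_of_le' (show 1 ≤ n by omega)
    have := Nat.add_one_mul_choose_eq b a
    rw [hM, hN, mul_comm ((a + 1 : ℕ) : ℝ)]
    exact_mod_cast this
  have hMN : N⁻¹ * M = (s : ℝ) / n := by field_simp; linarith
  have hrep : ∀ ω, nnWeight x (fun k => X k ω) n s i -
      (s : ℝ) / n * tailProb ν x (X i ω) ^ (s - 1) =
      N⁻¹ * ∑ S ∈ 𝓢, (nnInd x (fun k => X k ω) S i - tailProb ν x (X i ω) ^ (s - 1)) := by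
    intro ω
    rw [Finset.sum_sub_distrib, Finset.sum_const, nsmul_eq_mul, hcard, mul_sub, ← mul_assoc, hMN,
      nnWeight, h𝓢, Finset.sum_filter]
    congr 2
    refine Finset.sum_congr rfl fun S _ => ?_
    split_ifs with h
    · rfl
    · exact nnInd_of_notMem x _ h
  have hm : Measurable fun ω (k : ℕ) => X k ω := measurable_pi_lambda _ hX
  have hint : ∀ S T, Integrable (fun ω =>
      (nnInd x (fun k => X k ω) S i - tailProb ν x (X i ω) ^ (s - 1)) *
        (nnInd x (fun k => X k ω) T i - tailProb ν x (X i ω) ^ (s - 1))) P := by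
    have hb : ∀ S ω, |nnInd x (fun k => X k ω) S i - tailProb ν x (X i ω) ^ (s - 1)| ≤ 1 := by
      intro S ω
      have h1 := nnInd_nonneg x (fun k => X k ω) S i
      have h2 := nnInd_le_one x (fun k => X k ω) S i
      have h3 := pow_nonneg (tailProb_nonneg ν x (X i ω)) (s - 1)
      have h4 := pow_le_one₀ (n := s - 1) (tailProb_nonneg ν x (X i ω))
        (tailProb_le_one ν x (X i ω))
      rw [abs_le]; constructor <;> linarith
    have hms : ∀ S, Measurable fun ω => nnInd x (fun k => X k ω) S i -
        tailProb ν x (X i ω) ^ (s - 1) := fun S =>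
      ((measurable_nnInd x S i).comp hm).sub
        (((measurable_tailProb ν x).comp (hX i)).pow_const _)
    intro S T
    refine Integrable.of_bound (C := 1) ((hms S).mul (hms T)).aestronglyMeasurable
      (ae_of_all _ fun ω => ?_)
    rw [norm_mul]
    exact mul_le_one₀ (hb S ω) (norm_nonneg _) (hb T ω)
  have hcalc : ∫ ω, (nnWeight x (fun k => X k ω) n s i -
        (s : ℝ) / n * tailProb ν x (X i ω) ^ (s - 1)) ^ 2 ∂P =
      N⁻¹ ^ 2 * ∑ S ∈ 𝓢, ∑ T ∈ 𝓢, ∫ ω,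
        (nnInd x (fun k => X k ω) S i - tailProb ν x (X i ω) ^ (s - 1)) *
        (nnInd x (fun k => X k ω) T i - tailProb ν x (X i ω) ^ (s - 1)) ∂P := by
    simp_rw [hrep, mul_pow, integral_const_mul]
    congr 1
    simp_rw [sq, Finset.sum_mul_sum]
    rw [integral_finsetSum _ fun S _ => integrable_finsetSum _ fun T _ => hint S T]
    exact Finset.sum_congr rfl fun S _ => integral_finsetSum _ fun T _ => hint S T
  have hsum : ∀ S ∈ 𝓢, ∑ T ∈ 𝓢, ∫ ω,
        (nnInd x (fun k => X k ω) S i - tailProb ν x (X i ω) ^ (s - 1)) *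
        (nnInd x (fun k => X k ω) T i - tailProb ν x (X i ω) ^ (s - 1)) ∂P ≤
      M * ((s : ℝ) / n / (2 * s - 1)) := by
    intro S hS
    obtain ⟨hS1, hiS⟩ := Finset.mem_filter.1 hS
    obtain ⟨hSn, hSc⟩ := Finset.mem_powersetCard.1 hS1
    have h1 := sum_card_inter_sub_one hs hsn hSn hSc hiS
    rw [← h𝓢, ← hM] at h1
    have h2 : ∑ T ∈ 𝓢, (((S ∩ T).card : ℝ) - 1) = (s - 1) ^ 2 / (n - 1) * M := by
      rw [div_mul_eq_mul_div, eq_div_iff (by linarith), ← h1, mul_comm]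
    calc _ ≤ ∑ T ∈ 𝓢, (((S ∩ T).card : ℝ) - 1) / (s * (2 * s - 1)) :=
          Finset.sum_le_sum fun T hT => by
            obtain ⟨hT1, hiT⟩ := Finset.mem_filter.1 hT
            exact integral_nnInd_sub_mul_nnInd_sub_le hX hind hlaw hν hSc
              (Finset.mem_powersetCard.1 hT1).2 hiS hiT
      _ = M * (((s : ℝ) - 1) ^ 2 / ((n - 1) * s) / (2 * s - 1)) := by
          rw [← Finset.sum_div, h2]
          have : (n : ℝ) - 1 ≠ 0 := by linarith
          have : 2 * (s : ℝ) - 1 ≠ 0 := by linarith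
          field_simp
      _ ≤ _ := by
          have hM0 : 0 ≤ M := by positivity
          have h3 : (0 : ℝ) < 2 * s - 1 := by linarith
          have h4 : ((s : ℝ) - 1) ^ 2 / ((n - 1) * s) ≤ (s : ℝ) / n := by
            rw [div_le_div_iff₀ (mul_pos (by linarith) (by linarith)) (by linarith)]
            nlinarith
          gcongr
  rw [hcalc]
  calc N⁻¹ ^ 2 * ∑ S ∈ 𝓢, ∑ T ∈ 𝓢, ∫ ω,
        (nnInd x (fun k => X k ω) S i - tailProb ν x (X i ω) ^ (s - 1)) *
        (nnInd x (fun k => X k ω) T i - tailProb ν x (X i ω) ^ (s - 1)) ∂P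
      ≤ N⁻¹ ^ 2 * ∑ S ∈ 𝓢, M * ((s : ℝ) / n / (2 * s - 1)) := by
        gcongr with S hS; exact hsum S hS
    _ = (N⁻¹ * M) ^ 2 * ((s : ℝ) / n / (2 * s - 1)) := by
        rw [Finset.sum_const, nsmul_eq_mul, hcard]; ring
    _ = _ := by rw [hMN]

end secondMoments

/-! ### The noiseless estimator -/

section noiseless

variable {d : ℕ} {Ω : Type*} [MeasurableSpace Ω] {P : Measure Ω}
  {X : ℕ → Ω → EuclideanSpace ℝ (Fin d)} {ν : Measure (EuclideanSpace ℝ (Fin d))}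
  {x : EuclideanSpace ℝ (Fin d)} {μ : EuclideanSpace ℝ (Fin d) → ℝ}

theorem memLp_nnEstimator (hX : ∀ i, Measurable (X i)) (hlaw : ∀ i, P.map (X i) = ν)
    (hμ2 : MemLp μ 2 ν) (S : Finset ℕ) :
    MemLp (fun ω => nnEstimator x (fun k => (X k ω, μ (X k ω))) S) 2 P := by
  have hm : Measurable fun ω (k : ℕ) => X k ω := measurable_pi_lambda _ hX
  simp_rw [nnEstimator_eq_sum]
  refine memLp_finsetSum _ fun i _ => ?_
  have h1 : MemLp (fun ω => μ (X i ω)) 2 P :=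
    MemLp.comp_of_map (by rw [hlaw i]; exact hμ2) (hX i).aemeasurable
  refine h1.of_le (((measurable_nnInd x S i).comp hm).aestronglyMeasurable.mul h1.1)
    (ae_of_all _ fun ω => ?_)
  rw [norm_mul]
  exact mul_le_of_le_one_left (norm_nonneg _) (abs_nnInd_le_one _ _ _ _)

/-- The estimators of disjoint subsamples are independent. -/
theorem indepFun_nnEstimator (hX : ∀ i, Measurable (X i)) (hind : iIndepFun X P)
    (hμ : Measurable μ) {S T : Finset ℕ} (hST : Disjoint S T) :
    IndepFun (fun ω => nnEstimator x (fun k => (X k ω, μ (X k ω))) S)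
      (fun ω => nnEstimator x (fun k => (X k ω, μ (X k ω))) T) P := by
  classical
  -- the estimator as a function of the features of its subsample
  let ext : (R : Finset ℕ) → (R → EuclideanSpace ℝ (Fin d)) → ℕ → EuclideanSpace ℝ (Fin d) :=
    fun R w k => if h : k ∈ R then w ⟨k, h⟩ else 0
  let G : (R : Finset ℕ) → (R → EuclideanSpace ℝ (Fin d)) → ℝ := fun R w =>
    ∑ i ∈ R, nnInd x (ext R w) R i * μ (ext R w i)
  have hext : ∀ R, Measurable (ext R) := by
    intro R
    refine measurable_pi_lambda _ fun k => ?_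
    by_cases h : k ∈ R
    · simp only [ext, h, dite_true]; exact measurable_pi_apply _
    · simp only [ext, h, dite_false]; exact measurable_const
  have hG : ∀ R, Measurable (G R) := fun R => Finset.measurable_sum _ fun i _ =>
    ((measurable_nnInd x R i).comp (hext R)).mul
      (hμ.comp ((measurable_pi_apply i).comp (hext R)))
  have hrep : ∀ R, (fun ω => nnEstimator x (fun k => (X k ω, μ (X k ω))) R) =
      G R ∘ fun ω (k : R) => X k ω := by
    intro R
    funext ω
    have he : ∀ j ∈ R, X j ω = ext R (fun k : R => X k ω) j := fun j hj => by simp [ext, hj]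
    rw [nnEstimator_eq_sum]
    simp only [Function.comp, G]
    refine Finset.sum_congr rfl fun i hi => ?_
    rw [← he i hi, nnInd_congr x he]
  rw [hrep S, hrep T]
  exact (hind.indepFun_finset S T hST hX).comp (hG S) (hG T)

variable [IsProbabilityMeasure P]

/-- The expectation of a function of the regression function at the nearest neighbour. -/
theorem integral_comp_nnEstimator (hX : ∀ i, Measurable (X i)) (hind : iIndepFun X P)
    (hlaw : ∀ i, P.map (X i) = ν) (hν : ∀ r, ν {w | dist w x = r} = 0) {φ : ℝ → ℝ}
    (hφ : Integrable (fun z => φ (μ z)) ν) {S : Finset ℕ} (hS : S.Nonempty) :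
    ∫ ω, φ (nnEstimator x (fun k => (X k ω, μ (X k ω))) S) ∂P =
      S.card * ∫ z, φ (μ z) * tailProb ν x z ^ (S.card - 1) ∂ν := by
  have hm : Measurable fun ω (k : ℕ) => X k ω := measurable_pi_lambda _ hX
  have h1 : ∀ ω, φ (nnEstimator x (fun k => (X k ω, μ (X k ω))) S) =
      ∑ i ∈ S, φ (μ (X i ω)) * nnInd x (fun k => X k ω) S i := by
    intro ω
    rw [nnEstimator_eq_sum]
    obtain ⟨i, hi, hij⟩ := exists_nnInd_eq x (fun k => X k ω) hS
    simp [hij, hi]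
  simp_rw [h1]
  rw [integral_finsetSum, Finset.sum_congr rfl fun i hi =>
    integral_mul_nnInd hX hind hlaw hν hi hφ, Finset.sum_const, nsmul_eq_mul]
  intro i _
  have h2 : Integrable (fun ω => φ (μ (X i ω))) P :=
    Integrable.comp_measurable (g := fun z => φ (μ z)) (by rw [hlaw i]; exact hφ) (hX i)
  exact h2.mul_bdd (c := 1) ((measurable_nnInd x S i).comp hm).aestronglyMeasurable
    (ae_of_all _ fun ω => abs_nnInd_le_one _ _ _ _)

/-- The variance of the noiseless estimator is of smaller order than `s / n`, because the regression
function is nearly constant at the nearest neighbours. -/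
theorem integral_sq_dnn_sub_le (hX : ∀ i, Measurable (X i)) (hind : iIndepFun X P)
    (hlaw : ∀ i, P.map (X i) = ν) (hν : ∀ r, ν {w | dist w x = r} = 0) (hμ : Measurable μ)
    (hμ2 : MemLp μ 2 ν) {n s : ℕ} (hs : 1 ≤ s) (hsn : s ≤ n) :
    ∫ ω, (dnn x (fun k => (X k ω, μ (X k ω))) n s -
        s * ∫ z, μ z * tailProb ν x z ^ (s - 1) ∂ν) ^ 2 ∂P ≤
      2 * (s : ℝ) / n * (s * ∫ z, (μ z - μ x) ^ 2 * tailProb ν x z ^ (s - 1) ∂ν) := by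
  have : IsProbabilityMeasure ν := hlaw 0 ▸ Measure.isProbabilityMeasure_map (hX 0).aemeasurable
  set m : ℝ := s * ∫ z, μ z * tailProb ν x z ^ (s - 1) ∂ν with hm
  let V : Finset ℕ → Ω → ℝ := fun S ω => nnEstimator x (fun k => (X k ω, μ (X k ω))) S
  have hV2 : ∀ S, MemLp (V S) 2 P := fun S => memLp_nnEstimator hX hlaw hμ2 S
  have hμ1 : Integrable μ ν := hμ2.integrable one_le_two
  have hne : ∀ S ∈ (Finset.range n).powersetCard s, S.Nonempty := fun S hS =>
    Finset.card_pos.1 ((Finset.mem_powersetCard.1 hS).2 ▸ hs)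
  have hmean : ∀ S ∈ (Finset.range n).powersetCard s, ∫ ω, V S ω ∂P = m := fun S hS => by
    have := integral_comp_nnEstimator hX hind hlaw hν (φ := fun y => y) hμ1 (hne S hS)
    rw [(Finset.mem_powersetCard.1 hS).2] at this
    exact this
  have hN : (n.choose s : ℝ) ≠ 0 := by exact_mod_cast (Nat.choose_pos hsn).ne'
  have hrep : ∀ ω, dnn x (fun k => (X k ω, μ (X k ω))) n s - m =
      (n.choose s : ℝ)⁻¹ * ∑ S ∈ (Finset.range n).powersetCard s, (V S ω - m) := by
    intro ω
    rw [Finset.sum_sub_distrib, Finset.sum_const, Finset.card_powersetCard, Finset.card_range,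
      nsmul_eq_mul, mul_sub, inv_mul_cancel_left₀ hN]
    rfl
  simp_rw [hrep]
  refine integral_sq_average_powersetCard_le P hs hsn (fun S ω => V S ω - m)
    (fun S _ => (hV2 S).sub (memLp_const m)) (fun S hS => ?_) fun S hS T hT hST => ?_
  · -- centring at the mean minimises the second moment
    have h1 := integral_comp_nnEstimator hX hind hlaw hν (x := x) (φ := fun y => (y - μ x) ^ 2)
      ((hμ2.sub (memLp_const (μ x))).integrable_sq) (hne S hS)
    rw [(Finset.mem_powersetCard.1 hS).2] at h1
    rw [← h1]
    have h2 : ∀ ω, (V S ω - μ x) ^ 2 =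
        (V S ω - m) ^ 2 + (2 * (m - μ x) * (V S ω - m) + (m - μ x) ^ 2) := fun ω => by ring
    have i1 : Integrable (fun ω => (V S ω - m) ^ 2) P :=
      ((hV2 S).sub (memLp_const m)).integrable_sq
    have i2 : Integrable (fun ω => V S ω - m) P :=
      ((hV2 S).sub (memLp_const m)).integrable one_le_two
    have h3 : ∫ ω, (V S ω - μ x) ^ 2 ∂P = ∫ ω, (V S ω - m) ^ 2 ∂P + (m - μ x) ^ 2 := by
      simp_rw [h2]
      have i3 : Integrable (fun ω => 2 * (m - μ x) * (V S ω - m) + (m - μ x) ^ 2) P :=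
        (i2.const_mul _).add (integrable_const _)
      rw [integral_add i1 i3,
        integral_add (i2.const_mul _) (integrable_const _), integral_const_mul,
        integral_sub ((hV2 S).integrable one_le_two) (integrable_const _), hmean S hS]
      simp
    change ∫ ω, (V S ω - m) ^ 2 ∂P ≤ ∫ ω, (V S ω - μ x) ^ 2 ∂P
    rw [h3]
    linarith [sq_nonneg (m - μ x)]
  · have hI : IndepFun (fun ω => V S ω - m) (fun ω => V T ω - m) P :=
      (indepFun_nnEstimator hX hind hμ hST).comp (φ := fun y => y - m) (ψ := fun y => y - m)
        (by fun_prop) (by fun_prop)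
    have h1 := hI.integral_fun_mul_eq_mul_integral
      ((hV2 S).sub (memLp_const m)).1 ((hV2 T).sub (memLp_const m)).1
    rw [h1, integral_sub ((hV2 S).integrable one_le_two) (integrable_const _), hmean S hS]
    simp

end noiseless

/-! ### A central limit theorem for weighted noises -/

section clt

variable {E Ω : Type*} [MeasurableSpace E] [MeasurableSpace Ω] {P : Measure Ω}
  [IsProbabilityMeasure P]

theorem charFun_map_mul_of_indepFun {ξ : Ω → E} {ε : Ω → ℝ} (hξ : Measurable ξ)
    (hε : Measurable ε) (hind : IndepFun ξ ε P) {b : E → ℝ} (hb : Measurable b) (u : ℝ) :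
    charFun (P.map fun ω => b (ξ ω) * ε ω) u =
      ∫ ω, charFun (P.map ε) (u * b (ξ ω)) ∂P := by
  have hpε : IsProbabilityMeasure (P.map ε) := Measure.isProbabilityMeasure_map hε.aemeasurable
  have hpξ : IsProbabilityMeasure (P.map ξ) := Measure.isProbabilityMeasure_map hξ.aemeasurable
  have hjoint := (indepFun_iff_map_prod_eq_prod_map_map hξ.aemeasurable hε.aemeasurable).1 hind
  have hm : Measurable fun q : E × ℝ => Complex.exp (u * (b q.1 * q.2 : ℝ) * Complex.I) := by
    fun_prop
  have hint : Integrable (fun q : E × ℝ => Complex.exp (u * (b q.1 * q.2 : ℝ) * Complex.I))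
      ((P.map ξ).prod (P.map ε)) := by
    refine Integrable.of_bound (C := 1) hm.aestronglyMeasurable (ae_of_all _ fun q => ?_)
    rw [← Complex.ofReal_mul, Complex.norm_exp_ofReal_mul_I]
  rw [charFun_apply_real, integral_map
    (show AEMeasurable (fun ω => b (ξ ω) * ε ω) P from ((hb.comp hξ).mul hε).aemeasurable)
    (by fun_prop)]
  have h1 := integral_map (μ := P) (φ := fun ω => (ξ ω, ε ω)) (hξ.prodMk hε).aemeasurable
    (f := fun q : E × ℝ => Complex.exp (u * (b q.1 * q.2 : ℝ) * Complex.I))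
    hm.aestronglyMeasurable
  rw [← h1, hjoint, integral_prod _ hint]
  have h2 : ∀ z : E, ∫ e, Complex.exp (u * (b z * e : ℝ) * Complex.I) ∂(P.map ε) =
      charFun (P.map ε) (u * b z) := fun z => by
    rw [charFun_apply_real]
    congr 1 with e
    push_cast
    ring_nf
  simp only [h2]
  rw [integral_map hξ.aemeasurable]
  exact (continuous_charFun.measurable.comp (hb.const_mul u)).aestronglyMeasurable

/-- Sums of i.i.d. standardised noises with weights `b n (X i)`, where the weight functions have
unit second moment and are uniformly of smaller order than `√n`, are asymptotically normal.
Conditioning on the features reduces the expansion of the characteristic function to that of the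
noise. -/
theorem tendstoInDistribution_weighted_sum {X : ℕ → Ω → E} {ε : ℕ → Ω → ℝ}
    (hX : ∀ i, Measurable (X i)) (hε : ∀ i, Measurable (ε i)) (hXε : IndepFun (X 0) (ε 0) P)
    (hind : iIndepFun (fun i ω => (X i ω, ε i ω)) P)
    (hident : ∀ i, IdentDistrib (fun ω => (X i ω, ε i ω)) (fun ω => (X 0 ω, ε 0 ω)) P P)
    (h0 : ∫ ω, ε 0 ω ∂P = 0) (h1 : ∫ ω, ε 0 ω ^ 2 ∂P = 1) {b : ℕ → E → ℝ}
    (hb : ∀ n, Measurable (b n)) {K : ℕ → ℝ} (hbK : ∀ n z, |b n z| ≤ K n)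
    (hb2 : ∀ᶠ n in atTop, ∫ ω, b n (X 0 ω) ^ 2 ∂P = 1)
    (hK : Tendsto (fun n : ℕ => K n / √n) atTop (𝓝 0)) :
    TendstoInDistribution (fun (n : ℕ) ω => (√n)⁻¹ * ∑ i ∈ Finset.range n, b n (X i ω) * ε i ω)
      atTop (id : ℝ → ℝ) (fun _ => P) (gaussianReal 0 1) where
  forall_aemeasurable n := (Finset.measurable_sum _ fun i _ =>
    ((hb n).comp (hX i)).mul (hε i)).const_mul _ |>.aemeasurable
  tendsto := by
    refine ProbabilityMeasure.tendsto_iff_tendsto_charFun.2 fun t => ?_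
    simp only [ProbabilityMeasure.coe_mk, Measure.map_id, charFun_gaussianReal]
    have hmul : ∀ n, Measurable fun q : E × ℝ => b n q.1 * q.2 := fun n =>
      ((hb n).comp measurable_fst).mul measurable_snd
    have hchar : ∀ n : ℕ, charFun (P.map fun ω => (√n)⁻¹ *
        ∑ i ∈ Finset.range n, b n (X i ω) * ε i ω) t =
        (∫ ω, charFun (P.map (ε 0)) ((√n)⁻¹ * t * b n (X 0 ω)) ∂P) ^ n := by
      intro n
      have h2 := charFun_inv_sqrt_mul_sum (P := P) (X := fun i ω => b n (X i ω) * ε i ω)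
        (hind.comp (fun _ q => b n q.1 * q.2) fun _ => hmul n)
        (fun i => (hident i).comp (hmul n)) (n := n) (t := t)
      rw [h2, charFun_map_mul_of_indepFun (hX 0) (hε 0) hXε (hb n)]
    simp_rw [hchar]
    have hlim : Complex.exp (t * (0 : ℝ) * Complex.I - (1 : NNReal) * t ^ 2 / 2) =
        Complex.exp (-(t ^ 2 / 2)) := by simp
    rw [hlim]
    refine Complex.tendsto_pow_exp_of_isLittleO_sub_add_div _ ?_
    have htaylor := taylor_charFun_two (hε 0).aemeasurable h0 (by simpa using h1)
    rw [isLittleO_iff]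
    intro c hc
    -- `t ^ 2 + 1` instead of `t ^ 2` covers the case `t = 0`
    set η : ℝ := c / (t ^ 2 + 1) with hη
    obtain ⟨δ, hδ, hball⟩ := Metric.eventually_nhds_iff_ball.1
      ((isLittleO_iff.1 htaylor) (show 0 < η by positivity))
    have hK' : Tendsto (fun n : ℕ => |t| * (K n / √n)) atTop (𝓝 0) := by
      simpa using hK.const_mul |t|
    have hpε : IsProbabilityMeasure (P.map (ε 0)) :=
      Measure.isProbabilityMeasure_map (hε 0).aemeasurable
    filter_upwards [hb2, hK'.eventually (gt_mem_nhds hδ), eventually_gt_atTop 0] with n hn2 hnδ hn0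
    have hnpos : (0 : ℝ) < n := by exact_mod_cast hn0
    set u : ℝ := (√n)⁻¹ * t with hu
    have husq : u ^ 2 = t ^ 2 / n := by
      rw [hu, mul_pow, inv_pow, Real.sq_sqrt hnpos.le]; ring
    have hsmall : ∀ z, u * b n z ∈ Metric.ball (0 : ℝ) δ := by
      intro z
      rw [mem_ball_zero_iff, Real.norm_eq_abs]
      refine lt_of_le_of_lt ?_ hnδ
      rw [hu, abs_mul, abs_mul, abs_of_pos (by positivity : 0 < (√(n : ℝ))⁻¹)]
      calc (√(n : ℝ))⁻¹ * |t| * |b n z| ≤ (√(n : ℝ))⁻¹ * |t| * K n := by gcongr; exact hbK n z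
        _ = |t| * (K n / √n) := by ring
    have hbint : Integrable (fun ω => b n (X 0 ω) ^ 2) P := by
      refine Integrable.of_bound (C := K n ^ 2)
        (((hb n).comp (hX 0)).pow_const 2).aestronglyMeasurable (ae_of_all _ fun ω => ?_)
      rw [norm_pow, Real.norm_eq_abs]
      exact pow_le_pow_left₀ (abs_nonneg _) (hbK n _) 2
    have hcint : Integrable (fun ω => charFun (P.map (ε 0)) (u * b n (X 0 ω))) P :=
      Integrable.of_bound (C := 1) (continuous_charFun.measurable.comp
        (((hb n).comp (hX 0)).const_mul u)).aestronglyMeasurable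
        (ae_of_all _ fun ω => norm_charFun_le_one _)
    have hqint : Integrable (fun ω => ((u ^ 2 / 2 * b n (X 0 ω) ^ 2 : ℝ) : ℂ)) P :=
      (hbint.const_mul _).ofReal
    have hqval : ∫ ω, ((u ^ 2 / 2 * b n (X 0 ω) ^ 2 : ℝ) : ℂ) ∂P = ((u ^ 2 / 2 : ℝ) : ℂ) := by
      rw [integral_complex_ofReal, integral_const_mul, hn2, mul_one]
    have hdiff : (∫ ω, charFun (P.map (ε 0)) (u * b n (X 0 ω)) ∂P) -
        (1 + -((t : ℂ) ^ 2 / 2) / n) =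
        ∫ ω, (charFun (P.map (ε 0)) (u * b n (X 0 ω)) -
          (1 - ((u ^ 2 / 2 * b n (X 0 ω) ^ 2 : ℝ) : ℂ))) ∂P := by
      have h1q : Integrable (fun ω => (1 : ℂ) - ((u ^ 2 / 2 * b n (X 0 ω) ^ 2 : ℝ) : ℂ)) P :=
        (integrable_const _).sub hqint
      rw [integral_sub hcint h1q,
        integral_sub (integrable_const _) hqint, hqval, husq]
      simp
      ring
    rw [hdiff]
    have hpt : ∀ ω, ‖charFun (P.map (ε 0)) (u * b n (X 0 ω)) -
          (1 - ((u ^ 2 / 2 * b n (X 0 ω) ^ 2 : ℝ) : ℂ))‖ ≤ η * u ^ 2 * b n (X 0 ω) ^ 2 := by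
      intro ω
      have h3 := hball _ (hsmall (X 0 ω))
      have h4 : ((u ^ 2 / 2 * b n (X 0 ω) ^ 2 : ℝ) : ℂ) = ((u * b n (X 0 ω) : ℝ) : ℂ) ^ 2 / 2 := by
        push_cast; ring
      rw [h4]
      refine h3.trans (le_of_eq ?_)
      rw [norm_pow, Real.norm_eq_abs, sq_abs]
      ring
    refine (norm_integral_le_of_norm_le (hbint.const_mul (η * u ^ 2)) (ae_of_all _ hpt)).trans ?_
    rw [integral_const_mul, hn2, mul_one, husq, norm_div, norm_one, Complex.norm_natCast, hη]
    rw [div_mul_div_comm, ← mul_div_assoc, mul_one, div_le_div_iff₀ (by positivity) hnpos]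
    nlinarith [mul_pos hc hnpos]

end clt

/-- Convergence to zero in mean square implies convergence to zero in measure. -/
theorem tendstoInMeasure_zero_of_integral_sq {Ω : Type*} [MeasurableSpace Ω] {P : Measure Ω}
    {g : ℕ → Ω → ℝ} (hg : ∀ n, MemLp (g n) 2 P)
    (h : Tendsto (fun n => ∫ ω, g n ω ^ 2 ∂P) atTop (𝓝 0)) :
    TendstoInMeasure P g atTop 0 := by
  refine tendstoInMeasure_of_tendsto_eLpNorm (p := 2) (by norm_num) (fun n => (hg n).1)
    aestronglyMeasurable_zero ?_
  have h1 : ∀ n, eLpNorm (g n - 0) 2 P = ENNReal.ofReal ((∫ ω, g n ω ^ 2 ∂P) ^ (1 / 2 : ℝ)) := by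
    intro n
    rw [sub_zero, (hg n).eLpNorm_eq_integral_rpow_norm (by norm_num) (by norm_num)]
    simp
  simp_rw [h1]
  have h2 := (h.rpow_const (p := (1 / 2 : ℝ)) (Or.inr (by norm_num)))
  rw [Real.zero_rpow (by norm_num)] at h2
  simpa using ENNReal.tendsto_ofReal h2

/-! ### Decomposition of the estimator -/

section decomposition

variable {d : ℕ} {Ω : Type*} [MeasurableSpace Ω] {P : Measure Ω}
  {X : ℕ → Ω → EuclideanSpace ℝ (Fin d)} {ε : ℕ → Ω → ℝ} {ν : Measure (EuclideanSpace ℝ (Fin d))}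
  {x : EuclideanSpace ℝ (Fin d)} {μ : EuclideanSpace ℝ (Fin d) → ℝ}

theorem dnn_add_noise (x : EuclideanSpace ℝ (Fin d)) (p : ℕ → EuclideanSpace ℝ (Fin d))
    (y e : ℕ → ℝ) (n s : ℕ) :
    dnn x (fun i => (p i, y i + e i)) n s =
      dnn x (fun i => (p i, y i)) n s + ∑ i ∈ Finset.range n, nnWeight x p n s i * e i := by
  simp only [dnn_eq_sum_nnWeight, ← Finset.sum_add_distrib, mul_add]

theorem abs_nnWeight_le_one (x : EuclideanSpace ℝ (Fin d)) (p : ℕ → EuclideanSpace ℝ (Fin d))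
    (n s i : ℕ) : |nnWeight x p n s i| ≤ 1 := by
  rw [abs_of_nonneg (nnWeight_nonneg x p n s i)]
  exact nnWeight_le_one x p n s i

theorem memLp_dnn (hX : ∀ i, Measurable (X i)) (hlaw : ∀ i, P.map (X i) = ν)
    (hμ2 : MemLp μ 2 ν) (n s : ℕ) :
    MemLp (fun ω => dnn x (fun i => (X i ω, μ (X i ω))) n s) 2 P :=
  (memLp_finsetSum _ fun S _ => memLp_nnEstimator hX hlaw hμ2 S).const_mul _

variable [IsProbabilityMeasure P]

theorem integral_dnn (hX : ∀ i, Measurable (X i)) (hind : iIndepFun X P)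
    (hlaw : ∀ i, P.map (X i) = ν) (hν : ∀ r, ν {w | dist w x = r} = 0) (hμ2 : MemLp μ 2 ν)
    {n s : ℕ} (hs : 1 ≤ s) (hsn : s ≤ n) :
    ∫ ω, dnn x (fun i => (X i ω, μ (X i ω))) n s ∂P =
      s * ∫ z, μ z * tailProb ν x z ^ (s - 1) ∂ν := by
  have : IsProbabilityMeasure ν := hlaw 0 ▸ Measure.isProbabilityMeasure_map (hX 0).aemeasurable
  have hN : (n.choose s : ℝ) ≠ 0 := by exact_mod_cast (Nat.choose_pos hsn).ne'
  simp only [dnn]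
  rw [integral_const_mul, integral_finsetSum _ fun S _ =>
    (memLp_nnEstimator hX hlaw hμ2 S).integrable one_le_two]
  rw [Finset.sum_congr rfl (g := fun _ => s * ∫ z, μ z * tailProb ν x z ^ (s - 1) ∂ν)]
  · rw [Finset.sum_const, Finset.card_powersetCard, Finset.card_range, nsmul_eq_mul,
      inv_mul_cancel_left₀ hN]
  · intro S hS
    have hc := (Finset.mem_powersetCard.1 hS).2
    have h := integral_comp_nnEstimator (φ := id) hX hind hlaw hν (hμ2.integrable one_le_two)
      (Finset.card_pos.1 (hc ▸ hs))
    rw [hc] at h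
    exact h

theorem memLp_tailProb_noise (hX : ∀ i, Measurable (X i)) (hlaw : ∀ i, P.map (X i) = ν)
    (hε2 : ∀ i, MemLp (ε i) 2 P) (n m : ℕ) :
    MemLp (fun ω => ∑ i ∈ Finset.range n, tailProb ν x (X i ω) ^ m * ε i ω) 2 P := by
  have : IsProbabilityMeasure ν := hlaw 0 ▸ Measure.isProbabilityMeasure_map (hX 0).aemeasurable
  refine memLp_sum_mul (ξ := fun ω i => X i ω) (a := fun i p => tailProb ν x (p i) ^ m)
    (measurable_pi_lambda _ hX) hε2
    (fun i => ((measurable_tailProb ν x).comp (measurable_pi_apply i)).pow_const m)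
    (fun i p => ?_) n
  rw [abs_of_nonneg (pow_nonneg (tailProb_nonneg ν x _) m)]
  exact pow_le_one₀ (tailProb_nonneg ν x _) (tailProb_le_one ν x _)

/-- The mean square distance between the noise part of the estimator and its projection, where the
weight of the `i`-th observation is replaced by its conditional expectation given `X i`. -/
theorem integral_sq_noise_sub_le (hX : ∀ i, Measurable (X i)) (hε : ∀ i, Measurable (ε i))
    (hind : iIndepFun X P) (hXε : IndepFun (fun ω i => X i ω) (fun ω i => ε i ω) P)
    (hlaw : ∀ i, P.map (X i) = ν) (hν : ∀ r, ν {w | dist w x = r} = 0)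
    (hε2 : ∀ i, MemLp (ε i) 2 P) {v : ℝ} (hvar : ∀ i, ∫ ω, ε i ω ^ 2 ∂P = v)
    (hcov : ∀ i j, i ≠ j → ∫ ω, ε i ω * ε j ω ∂P = 0) {n s : ℕ} (hs : 1 ≤ s) (hsn : s ≤ n)
    (hn : 2 ≤ n) :
    ∫ ω, (∑ i ∈ Finset.range n, (nnWeight x (fun k => X k ω) n s i -
        (s : ℝ) / n * tailProb ν x (X i ω) ^ (s - 1)) * ε i ω) ^ 2 ∂P ≤
      v * (n * (((s : ℝ) / n) ^ 2 * ((s : ℝ) / n / (2 * s - 1)))) := by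
  have : IsProbabilityMeasure ν := hlaw 0 ▸ Measure.isProbabilityMeasure_map (hX 0).aemeasurable
  have hv : 0 ≤ v := hvar 0 ▸ integral_nonneg fun ω => sq_nonneg _
  have hnpos : (0 : ℝ) < n := by exact_mod_cast (by omega : 0 < n)
  have hp : 0 ≤ (s : ℝ) / n := by positivity
  have hp1 : (s : ℝ) / n ≤ 1 := (div_le_one hnpos).2 (by exact_mod_cast hsn)
  have h := integral_sq_sum_mul (ξ := fun ω i => X i ω)
    (a := fun i p => nnWeight x p n s i - (s : ℝ) / n * tailProb ν x (p i) ^ (s - 1))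
    (measurable_pi_lambda _ hX) hε hXε hε2 hvar hcov
    (fun i => (measurable_nnWeight x n s i).sub
      ((((measurable_tailProb ν x).comp (measurable_pi_apply i)).pow_const (s - 1)).const_mul _))
    (fun i p => ?_) n
  · rw [h]
    refine mul_le_mul_of_nonneg_left ?_ hv
    refine (Finset.sum_le_card_nsmul _ _ _ fun i hi =>
      integral_sq_nnWeight_sub_le hX hind hlaw hν hs hsn hn (Finset.mem_range.1 hi)).trans_eq ?_
    rw [Finset.card_range, nsmul_eq_mul]
  · have h1 := nnWeight_nonneg x p n s i
    have h2 := nnWeight_le_one x p n s i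
    have h3 : 0 ≤ tailProb ν x (p i) ^ (s - 1) := pow_nonneg (tailProb_nonneg ν x _) _
    have h4 : tailProb ν x (p i) ^ (s - 1) ≤ 1 :=
      pow_le_one₀ (tailProb_nonneg ν x _) (tailProb_le_one ν x _)
    have h5 := mul_nonneg hp h3
    have h6 := mul_le_one₀ hp1 h3 h4
    exact abs_le.2 ⟨by linarith, by linarith⟩

/-- The centred estimator differs from the projection of its noise part by a remainder whose mean
square is at most the sum of a term of smaller order than the variance of the projection and of one
governed by the mean square of `μ - μ x` at the nearest neighbour. -/
theorem integral_sq_dnn_sub_projection_le (hX : ∀ i, Measurable (X i))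
    (hε : ∀ i, Measurable (ε i)) (hind : iIndepFun X P)
    (hXε : IndepFun (fun ω i => X i ω) (fun ω i => ε i ω) P)
    (hlaw : ∀ i, P.map (X i) = ν) (hν : ∀ r, ν {w | dist w x = r} = 0) (hμ : Measurable μ)
    (hμ2 : MemLp μ 2 ν) (hε2 : ∀ i, MemLp (ε i) 2 P) {v : ℝ} (hvar : ∀ i, ∫ ω, ε i ω ^ 2 ∂P = v)
    (hcov : ∀ i j, i ≠ j → ∫ ω, ε i ω * ε j ω ∂P = 0) {n s : ℕ} (hs : 1 ≤ s) (hsn : s ≤ n)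
    (hn : 2 ≤ n) :
    ∫ ω, (dnn x (fun i => (X i ω, μ (X i ω) + ε i ω)) n s -
        s * ∫ z, μ z * tailProb ν x z ^ (s - 1) ∂ν -
        (s : ℝ) / n * ∑ i ∈ Finset.range n, tailProb ν x (X i ω) ^ (s - 1) * ε i ω) ^ 2 ∂P ≤
      2 * (v * (n * (((s : ℝ) / n) ^ 2 * ((s : ℝ) / n / (2 * s - 1))))) +
      2 * (2 * (s : ℝ) / n * (s * ∫ z, (μ z - μ x) ^ 2 * tailProb ν x z ^ (s - 1) ∂ν)) := by
  set m : ℝ := s * ∫ z, μ z * tailProb ν x z ^ (s - 1) ∂ν with hm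
  set A : Ω → ℝ := fun ω => ∑ i ∈ Finset.range n, (nnWeight x (fun k => X k ω) n s i -
    (s : ℝ) / n * tailProb ν x (X i ω) ^ (s - 1)) * ε i ω with hA
  set C : Ω → ℝ := fun ω => dnn x (fun i => (X i ω, μ (X i ω))) n s - m with hC
  have hdec : ∀ ω, dnn x (fun i => (X i ω, μ (X i ω) + ε i ω)) n s - m -
      (s : ℝ) / n * ∑ i ∈ Finset.range n, tailProb ν x (X i ω) ^ (s - 1) * ε i ω =
      A ω + C ω := by
    intro ω
    simp only [hA, hC, dnn_add_noise, sub_mul, Finset.sum_sub_distrib, Finset.mul_sum, mul_assoc]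
    ring
  have hC2 : MemLp C 2 P := (memLp_dnn hX hlaw hμ2 n s).sub (memLp_const m)
  have hA2 : MemLp A 2 P := by
    have h1 := memLp_sum_mul (ξ := fun ω i => X i ω) (a := fun i p => nnWeight x p n s i)
      (measurable_pi_lambda _ hX) hε2 (fun i => measurable_nnWeight x n s i)
      (fun i p => abs_nnWeight_le_one x p n s i) n
    have h2 := (memLp_tailProb_noise (x := x) hX hlaw hε2 n (s - 1)).const_mul ((s : ℝ) / n)
    refine (h1.sub h2).congr_norm ?_ (ae_of_all _ fun ω => ?_)
    · refine (h1.sub h2).1.congr (ae_of_all _ fun ω => ?_)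
      simp only [hA, Pi.sub_apply, sub_mul, Finset.sum_sub_distrib, Finset.mul_sum, mul_assoc]
    · simp only [hA, Pi.sub_apply, sub_mul, Finset.sum_sub_distrib, Finset.mul_sum, mul_assoc]
  have hAi : Integrable (fun ω => 2 * A ω ^ 2) P := hA2.integrable_sq.const_mul 2
  have hCi : Integrable (fun ω => 2 * C ω ^ 2) P := hC2.integrable_sq.const_mul 2
  calc ∫ ω, (dnn x (fun i => (X i ω, μ (X i ω) + ε i ω)) n s - m -
        (s : ℝ) / n * ∑ i ∈ Finset.range n, tailProb ν x (X i ω) ^ (s - 1) * ε i ω) ^ 2 ∂P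
      = ∫ ω, (A ω + C ω) ^ 2 ∂P := by simp_rw [hdec]
    _ ≤ ∫ ω, (2 * A ω ^ 2 + 2 * C ω ^ 2) ∂P := by
        refine integral_mono (hA2.add hC2).integrable_sq (hAi.add hCi) fun ω => ?_
        have := sq_nonneg (A ω - C ω)
        simp only
        nlinarith
    _ = 2 * ∫ ω, A ω ^ 2 ∂P + 2 * ∫ ω, C ω ^ 2 ∂P := by
        rw [integral_add hAi hCi, integral_const_mul, integral_const_mul]
    _ ≤ _ := by
        gcongr
        · exact integral_sq_noise_sub_le hX hε hind hXε hlaw hν hε2 hvar hcov hs hsn hn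
        · exact integral_sq_dnn_sub_le hX hind hlaw hν hμ hμ2 hs hsn

end decomposition

/-! ### Asymptotic normality -/

section normality

variable {d : ℕ} {Ω : Type*} [MeasurableSpace Ω] {P : Measure Ω} [IsProbabilityMeasure P]
  {X : ℕ → Ω → EuclideanSpace ℝ (Fin d)} {ε : ℕ → Ω → ℝ} {ν : Measure (EuclideanSpace ℝ (Fin d))}
  {x : EuclideanSpace ℝ (Fin d)} {μ : EuclideanSpace ℝ (Fin d) → ℝ}

/-- The mean square of `μ - μ x` at the nearest neighbour among `s` points tends to zero. -/
theorem tendsto_integral_sq_sub_mul_tailProb_pow [IsProbabilityMeasure ν]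
    (hν : ∀ r, ν {w | dist w x = r} = 0) (hx : x ∈ ν.support) (hμ2 : MemLp μ 2 ν)
    (hμc : ContinuousAt μ x) :
    Tendsto (fun s : ℕ => (s : ℝ) * ∫ z, (μ z - μ x) ^ 2 * tailProb ν x z ^ (s - 1) ∂ν) atTop
      (𝓝 0) := by
  have hint : Integrable (fun z => (μ z - μ x) ^ 2) ν := (hμ2.sub (memLp_const _)).integrable_sq
  have h := isLittleO_integral_mul_tailProb_pow hν hx le_rfl hint ?_
  · simpa using h
  · simp only [Real.rpow_zero]
    rw [isLittleO_one_iff]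
    have h1 : ContinuousAt (fun z => (μ z - μ x) ^ 2) x := (hμc.sub continuousAt_const).pow 2
    simpa [ContinuousAt] using h1

/-- The standard deviation of `s / n * ∑ i < n, tailProb ν x (X i) ^ (s - 1) * ε i`, when `v` is the
variance of the noise. -/
noncomputable def projectionSD (v : ℝ) (n s : ℕ) : ℝ := √v * s / √(n * (2 * s - 1))

theorem projectionSD_pos {v : ℝ} (hv : 0 < v) {n s : ℕ} (hs : 1 ≤ s) (hn : 1 ≤ n) :
    0 < projectionSD v n s := by
  have h1 : (1 : ℝ) ≤ s := by exact_mod_cast hs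
  have h2 : (1 : ℝ) ≤ n := by exact_mod_cast hn
  have h3 : (0 : ℝ) < 2 * s - 1 := by linarith
  unfold projectionSD
  positivity

theorem projectionSD_sq {v : ℝ} (hv : 0 < v) {n s : ℕ} (hs : 1 ≤ s) :
    projectionSD v n s ^ 2 = v * s ^ 2 / (n * (2 * s - 1)) := by
  have h1 : (1 : ℝ) ≤ s := by exact_mod_cast hs
  have h3 : (0 : ℝ) ≤ n * (2 * s - 1) := mul_nonneg n.cast_nonneg (by linarith)
  rw [projectionSD, div_pow, mul_pow, Real.sq_sqrt hv.le, Real.sq_sqrt h3]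

theorem projectionSD_sq_le {v : ℝ} (hv : 0 < v) {n s : ℕ} (hs : 1 ≤ s) (hn : 1 ≤ n) :
    projectionSD v n s ^ 2 ≤ v * (s / n) := by
  have h1 : (1 : ℝ) ≤ s := by exact_mod_cast hs
  have h2 : (1 : ℝ) ≤ n := by exact_mod_cast hn
  have h3 : (0 : ℝ) < 2 * s - 1 := by linarith
  have h4 : (s : ℝ) / (2 * s - 1) ≤ 1 := (div_le_one h3).2 (by linarith)
  rw [projectionSD_sq hv hs]
  calc v * s ^ 2 / (n * (2 * s - 1)) = v * (s / n) * (s / (2 * s - 1)) := by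
        field_simp
    _ ≤ v * (s / n) * 1 := by gcongr
    _ = v * (s / n) := mul_one _

/-- The projection of the noise part, divided by its standard deviation, is asymptotically
normal. -/
theorem tendstoInDistribution_projection (hX : ∀ i, Measurable (X i)) (hε : ∀ i, Measurable (ε i))
    (hXε : IndepFun (X 0) (ε 0) P) (hind : iIndepFun (fun i ω => (X i ω, ε i ω)) P)
    (hident : ∀ i, IdentDistrib (fun ω => (X i ω, ε i ω)) (fun ω => (X 0 ω, ε 0 ω)) P P)
    (hlaw : P.map (X 0) = ν) (hν : ∀ r, ν {w | dist w x = r} = 0)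
    (h0 : ∫ ω, ε 0 ω ∂P = 0) {v : ℝ} (hv : 0 < v) (h1 : ∫ ω, ε 0 ω ^ 2 ∂P = v) {s : ℕ → ℕ}
    (hs : Tendsto s atTop atTop) (hsn : Tendsto (fun n : ℕ => (s n : ℝ) / (n : ℝ)) atTop (𝓝 0)) :
    TendstoInDistribution (fun (n : ℕ) ω => (√n)⁻¹ * ∑ i ∈ Finset.range n,
        (√(2 * s n - 1) * tailProb ν x (X i ω) ^ (s n - 1)) * (ε i ω / √v))
      atTop (id : ℝ → ℝ) (fun _ => P) (gaussianReal 0 1) := by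
  have : IsProbabilityMeasure ν := hlaw ▸ Measure.isProbabilityMeasure_map (hX 0).aemeasurable
  have hscale : Measurable fun q : EuclideanSpace ℝ (Fin d) × ℝ => (q.1, q.2 / √v) := by fun_prop
  refine tendstoInDistribution_weighted_sum (ε := fun i ω => ε i ω / √v)
    (b := fun n z => √(2 * s n - 1) * tailProb ν x z ^ (s n - 1)) (K := fun n => √(2 * s n - 1))
    hX (fun i => (hε i).div_const _) (hXε.comp measurable_id (measurable_id.div_const (√v)))
    (hind.comp (fun _ q => (q.1, q.2 / √v)) fun _ => hscale) (fun i => (hident i).comp hscale)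
    ?_ ?_ (fun n => ((measurable_tailProb ν x).pow_const _).const_mul _) (fun n z => ?_) ?_ ?_
  · rw [integral_div, h0, zero_div]
  · simp_rw [div_pow, Real.sq_sqrt hv.le]
    rw [integral_div, h1, div_self hv.ne']
  · rw [abs_of_nonneg (mul_nonneg (Real.sqrt_nonneg _) (pow_nonneg (tailProb_nonneg ν x z) _))]
    exact mul_le_of_le_one_right (Real.sqrt_nonneg _)
      (pow_le_one₀ (tailProb_nonneg ν x z) (tailProb_le_one ν x z))
  · filter_upwards [hs.eventually_ge_atTop 1] with n hn
    have hn1 : (1 : ℝ) ≤ s n := by exact_mod_cast hn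
    have hpos : (0 : ℝ) < 2 * s n - 1 := by linarith
    simp_rw [mul_pow, Real.sq_sqrt hpos.le, ← pow_mul]
    rw [integral_const_mul, ← integral_map (hX 0).aemeasurable (μ := P)
      (f := fun z => tailProb ν x z ^ ((s n - 1) * 2))
      ((measurable_tailProb ν x).pow_const _).aestronglyMeasurable, hlaw,
      integral_tailProb_pow hν]
    push_cast [Nat.cast_sub hn]
    rw [mul_one_div, div_eq_one_iff_eq (by linarith)]
    ring
  · have h2 : Tendsto (fun n : ℕ => (2 * (s n : ℝ) - 1) / n) atTop (𝓝 0) := by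
      have h3 := (hsn.const_mul 2).sub (tendsto_one_div_atTop_nhds_zero_nat (𝕜 := ℝ))
      rw [mul_zero, sub_zero] at h3
      exact h3.congr fun n => by ring
    have h3 := h2.sqrt
    rw [Real.sqrt_zero] at h3
    exact h3.congr fun n => Real.sqrt_div' _ n.cast_nonneg

theorem projection_div_projectionSD {v : ℝ} (hv : 0 < v) {n s : ℕ} (hs : 1 ≤ s) (hn : 1 ≤ n)
    (q e : ℕ → ℝ) :
    ((s : ℝ) / n * ∑ i ∈ Finset.range n, q i * e i) / projectionSD v n s =
      (√n)⁻¹ * ∑ i ∈ Finset.range n, (√(2 * s - 1) * q i) * (e i / √v) := by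
  have h1 : (1 : ℝ) ≤ s := by exact_mod_cast hs
  have h2 : (1 : ℝ) ≤ n := by exact_mod_cast hn
  have h3 : (0 : ℝ) < 2 * s - 1 := by linarith
  have hsv : √v ≠ 0 := (Real.sqrt_pos.2 hv).ne'
  have hsn : √(n : ℝ) ≠ 0 := (Real.sqrt_pos.2 (by linarith)).ne'
  have hs3 : √(2 * (s : ℝ) - 1) ≠ 0 := (Real.sqrt_pos.2 h3).ne'
  have hn2 : (n : ℝ) = √n * √n := (Real.mul_self_sqrt n.cast_nonneg).symm
  have hsum : ∑ i ∈ Finset.range n, (√(2 * s - 1) * q i) * (e i / √v) =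
      √(2 * s - 1) / √v * ∑ i ∈ Finset.range n, q i * e i := by
    rw [Finset.mul_sum]
    exact Finset.sum_congr rfl fun i _ => by ring
  rw [hsum, projectionSD, Real.sqrt_mul n.cast_nonneg]
  generalize ∑ i ∈ Finset.range n, q i * e i = t
  have hs0 : (s : ℝ) ≠ 0 := by positivity
  have hcoef : (s : ℝ) / n / (√v * s / (√n * √(2 * s - 1))) =
      (√n)⁻¹ * (√(2 * s - 1) / √v) := by
    rw [show (s : ℝ) / n = s / (√n * √n) by rw [← hn2]]
    field_simp
  rw [mul_div_right_comm, hcoef, mul_assoc]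

/-- The centred estimator, divided by the standard deviation of the projection of its noise part, is
asymptotically normal. -/
theorem exists_tendstoInDistribution_dnn (hX : ∀ i, Measurable (X i)) (hε : ∀ i, Measurable (ε i))
    (hXε : ∀ i, IndepFun (X i) (ε i) P) (hind : iIndepFun (fun i ω => (X i ω, ε i ω)) P)
    (hident : ∀ i, IdentDistrib (fun ω => (X i ω, ε i ω)) (fun ω => (X 0 ω, ε 0 ω)) P P)
    (hlaw : P.map (X 0) = ν) (hν : ∀ r, ν {w | dist w x = r} = 0) (hx : x ∈ ν.support)
    (hμ : Measurable μ) (hμ2 : MemLp μ 2 ν) (hμc : ContinuousAt μ x) (hε2 : MemLp (ε 0) 2 P)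
    (h0 : ∫ ω, ε 0 ω ∂P = 0) {v : ℝ} (hv : 0 < v) (h1 : ∫ ω, ε 0 ω ^ 2 ∂P = v) {s : ℕ → ℕ}
    (hs : Tendsto s atTop atTop) (hsn : Tendsto (fun n : ℕ => (s n : ℝ) / (n : ℝ)) atTop (𝓝 0)) :
    ∃ σ : ℕ → ℝ, (∀ n, 0 < σ n) ∧
      ((fun n : ℕ => σ n ^ 2) =O[atTop] fun n : ℕ => (s n : ℝ) / (n : ℝ)) ∧
      TendstoInDistribution (fun (n : ℕ) ω => (dnn x (fun i => (X i ω, μ (X i ω) + ε i ω)) n (s n) -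
          s n * ∫ z, μ z * tailProb ν x z ^ (s n - 1) ∂ν) / σ n)
        atTop (id : ℝ → ℝ) (fun _ => P) (gaussianReal 0 1) := by
  have : IsProbabilityMeasure ν := hlaw ▸ Measure.isProbabilityMeasure_map (hX 0).aemeasurable
  have hlaws : ∀ i, P.map (X i) = ν := fun i =>
    ((hident i).comp measurable_fst).map_eq.trans hlaw
  have hindX : iIndepFun X P := hind.comp (fun _ => Prod.fst) fun _ => measurable_fst
  have hindε : iIndepFun ε P := hind.comp (fun _ => Prod.snd) fun _ => measurable_snd
  have hidε : ∀ i, IdentDistrib (ε i) (ε 0) P P := fun i => (hident i).comp measurable_snd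
  have hXεseq := indepFun_seq_of_iIndepFun_prodMk hX hε hXε hind
  have hε2s : ∀ i, MemLp (ε i) 2 P := fun i => (hidε i).memLp_iff.2 hε2
  have hmean : ∀ i, ∫ ω, ε i ω ∂P = 0 := fun i => (hidε i).integral_eq.trans h0
  have hvar : ∀ i, ∫ ω, ε i ω ^ 2 ∂P = v := fun i =>
    ((hidε i).comp (measurable_id.pow_const 2)).integral_eq.trans h1
  have hcov : ∀ i j, i ≠ j → ∫ ω, ε i ω * ε j ω ∂P = 0 := fun i j hij => by
    rw [(hindε.indepFun hij).integral_fun_mul_eq_mul_integral (hε i).aestronglyMeasurable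
      (hε j).aestronglyMeasurable, hmean i, zero_mul]
  have hgood : ∀ᶠ n in atTop, 1 ≤ s n ∧ s n ≤ n ∧ 2 ≤ n := by
    filter_upwards [hs.eventually_ge_atTop 1, hsn.eventually (gt_mem_nhds zero_lt_one),
      eventually_ge_atTop 2] with n h1 h2 h3
    refine ⟨h1, ?_, h3⟩
    rw [div_lt_one (by exact_mod_cast (by omega : 0 < n))] at h2
    exact_mod_cast h2.le
  -- the value `1` on the finitely many irregular indices is immaterial
  let σ : ℕ → ℝ := fun n => if 0 < projectionSD v n (s n) then projectionSD v n (s n) else 1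
  have hσ : ∀ n, 1 ≤ s n → 1 ≤ n → σ n = projectionSD v n (s n) := fun n h h' =>
    if_pos (projectionSD_pos hv h h')
  refine ⟨σ, fun n => ?_, ?_, ?_⟩
  · simp only [σ]
    split_ifs with h
    · exact h
    · exact one_pos
  · refine IsBigO.of_bound v ?_
    filter_upwards [hgood] with n hn
    rw [hσ n hn.1 (by omega), Real.norm_of_nonneg (sq_nonneg _),
      Real.norm_of_nonneg (by positivity)]
    exact projectionSD_sq_le hv hn.1 (by omega)
  · set D : ℕ → Ω → ℝ := fun n ω => dnn x (fun i => (X i ω, μ (X i ω) + ε i ω)) n (s n) -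
      s n * ∫ z, μ z * tailProb ν x z ^ (s n - 1) ∂ν with hD
    have hD2 : ∀ n, MemLp (D n) 2 P := fun n => by
      have h2 := memLp_sum_mul (ξ := fun ω i => X i ω) (a := fun i p => nnWeight x p n (s n) i)
        (measurable_pi_lambda _ hX) hε2s (fun i => measurable_nnWeight x n (s n) i)
        (fun i p => abs_nnWeight_le_one x p n (s n) i) n
      have h3 := ((memLp_dnn (x := x) hX hlaws hμ2 n (s n)).add h2).sub
        (memLp_const ((s n : ℝ) * ∫ z, μ z * tailProb ν x z ^ (s n - 1) ∂ν))
      simp only [hD, dnn_add_noise]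
      exact h3
    set T : ℕ → Ω → ℝ := fun n ω => (√n)⁻¹ * ∑ i ∈ Finset.range n,
        (√(2 * s n - 1) * tailProb ν x (X i ω) ^ (s n - 1)) * (ε i ω / √v) with hT
    have hT2 : ∀ n, MemLp (T n) 2 P := fun n => by
      have h2 := (memLp_tailProb_noise (x := x) hX hlaws hε2s n (s n - 1)).const_mul
        ((√n)⁻¹ * (√(2 * s n - 1) / √v))
      convert h2 using 2 with ω
      simp only [hT, Finset.mul_sum]
      exact Finset.sum_congr rfl fun i _ => by ring
    have hclt := tendstoInDistribution_projection hX hε (hXε 0) hind hident hlaw hν h0 hv h1 hs hsn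
    refine tendstoInDistribution_of_tendstoInMeasure_sub _ _ hclt ?_
      fun n => (hD2 n).1.aemeasurable.div_const _
    have hdiff : ∀ n, MemLp (fun ω => D n ω / σ n - T n ω) 2 P := fun n => by
      have h2 := ((hD2 n).const_mul (σ n)⁻¹).sub (hT2 n)
      convert h2 using 2 with ω
      simp only [Pi.sub_apply]
      ring
    refine tendstoInMeasure_zero_of_integral_sq hdiff ?_
    have hvs := (tendsto_integral_sq_sub_mul_tailProb_pow hν hx hμ2 hμc).comp hs
    set V : ℕ → ℝ := fun k => (k : ℝ) * ∫ z, (μ z - μ x) ^ 2 * tailProb ν x z ^ (k - 1) ∂ν with hV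
    have hV0 : ∀ k, 0 ≤ V k := fun k => mul_nonneg k.cast_nonneg (integral_nonneg fun z =>
      mul_nonneg (sq_nonneg _) (pow_nonneg (tailProb_nonneg ν x z) _))
    have hbound : Tendsto (fun n => 2 * ((s n : ℝ) / n) + 8 / v * V (s n)) atTop (𝓝 0) := by
      simpa using (hsn.const_mul 2).add (hvs.const_mul (8 / v))
    refine tendsto_of_tendsto_of_tendsto_of_le_of_le' tendsto_const_nhds hbound
      (Eventually.of_forall fun n => integral_nonneg fun ω => sq_nonneg _) ?_
    filter_upwards [hgood] with n ⟨hn1, hn2, hn3⟩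
    have hs1 : (1 : ℝ) ≤ s n := by exact_mod_cast hn1
    have hn0 : (0 : ℝ) < n := by exact_mod_cast (by omega : 0 < n)
    have h2s : (0 : ℝ) < 2 * s n - 1 := by linarith
    have hσn : σ n = projectionSD v n (s n) := hσ n hn1 (by omega)
    have heq : ∀ ω, (D n ω / σ n - T n ω) ^ 2 = (projectionSD v n (s n) ^ 2)⁻¹ *
        (D n ω - (s n : ℝ) / n * ∑ i ∈ Finset.range n,
          tailProb ν x (X i ω) ^ (s n - 1) * ε i ω) ^ 2 := by
      intro ω
      simp only [hT]
      rw [hσn, ← projection_div_projectionSD hv hn1 (by omega)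
        (fun i => tailProb ν x (X i ω) ^ (s n - 1)) (fun i => ε i ω), ← sub_div, div_pow]
      ring
    have hle := integral_sq_dnn_sub_projection_le (x := x) hX hε hindX hXεseq hlaws hν hμ hμ2 hε2s
      hvar hcov hn1 hn2 hn3
    refine (integral_congr_ae (ae_of_all _ heq)).trans_le ?_
    rw [integral_const_mul]
    refine (mul_le_mul_of_nonneg_left hle (by positivity)).trans ?_
    rw [projectionSD_sq hv hn1]
    have hfrac : (2 * (s n : ℝ) - 1) / s n ≤ 2 := by
      rw [div_le_iff₀ (by linarith)]; linarith
    calc _ = 2 * ((s n : ℝ) / n) + 4 / v * V (s n) * ((2 * (s n : ℝ) - 1) / s n) := by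
          simp only [hV]
          generalize 2 * (s n : ℝ) - 1 = w at h2s ⊢
          field_simp
          ring
      _ ≤ 2 * ((s n : ℝ) / n) + 4 / v * V (s n) * 2 := by
          have := hV0 (s n)
          gcongr
      _ = _ := by ring

end normality

theorem theorem2 {d : ℕ} (hd : 0 < d)
    {Ω : Type*} [MeasurableSpace Ω] (P : Measure Ω) [IsProbabilityMeasure P]
    -- features, responses, noises, regression function, density of the features
    (X : ℕ → Ω → EuclideanSpace ℝ (Fin d)) (Y ε : ℕ → Ω → ℝ)
    (μ f : EuclideanSpace ℝ (Fin d) → ℝ)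
    (hX : ∀ i, Measurable (X i)) (hε : ∀ i, Measurable (ε i)) (hμ : Measurable μ)
    -- the model `Y = μ(X) + ε` with a noise that is independent of the features
    (hY : ∀ i ω, Y i ω = μ (X i ω) + ε i ω)
    (hXε : ∀ i, IndepFun (X i) (ε i) P)
    -- the observations `(X i, Y i)` are independent and identically distributed
    (hindep : iIndepFun (fun i ω => (X i ω, Y i ω)) P)
    (hident : ∀ i, IdentDistrib (fun ω => (X i ω, Y i ω)) (fun ω => (X 0 ω, Y 0 ω)) P P)
    -- the features have the density `f`, bounded away from `0` and `∞` (almost surely)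
    (hf : Measurable f) (hf0 : ∀ z, 0 ≤ f z)
    (hdens : P.map (X 0) = volume.withDensity (fun z => ENNReal.ofReal (f z)))
    (hfbdd : ∃ c C : ℝ, 0 < c ∧ ∀ᵐ z ∂(P.map (X 0)), c ≤ f z ∧ f z ≤ C)
    -- the target point lies in the support of the features
    (x : EuclideanSpace ℝ (Fin d)) (hx : x ∈ (P.map (X 0)).support)
    -- `f` and `μ` are `C²` with bounded second derivatives on a neighbourhood of `x`
    (hfx : ∃ U ∈ 𝓝 x, IsOpen U ∧ ContDiffOn ℝ 2 f U ∧
      ∃ M : ℝ, ∀ z ∈ U, ‖iteratedFDeriv ℝ 2 f z‖ ≤ M)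
    (hμx : ∃ U ∈ 𝓝 x, IsOpen U ∧ ContDiffOn ℝ 2 μ U ∧
      ∃ M : ℝ, ∀ z ∈ U, ‖iteratedFDeriv ℝ 2 μ z‖ ≤ M)
    -- moments of the response and of the noise
    (hY2 : MemLp (Y 0) 2 P) (hε2 : MemLp (ε 0) 2 P)
    (hε0 : ∫ ω, ε 0 ω ∂P = 0) (hεvar : 0 < variance (ε 0) P) :
    ∃ B : ℕ → ℝ,
      -- `B s` is the bias of the estimator with subsampling scale `s`, for all sample sizes
      (∀ n s : ℕ, 1 ≤ s → s ≤ n →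
        Integrable (fun ω => dnn x (fun i => (X i ω, Y i ω)) n s) P ∧
        ∫ ω, dnn x (fun i => (X i ω, Y i ω)) n s ∂P = μ x + B s) ∧
      -- its expansion
      ((fun s : ℕ => B s - biasCoeff f μ x * (s : ℝ) ^ (-2 / (d : ℝ)))
        =o[atTop] fun s : ℕ => (s : ℝ) ^ (-2 / (d : ℝ))) ∧
      -- asymptotic normality
      ∀ s : ℕ → ℕ, Tendsto s atTop atTop →
        Tendsto (fun n : ℕ => (s n : ℝ) / (n : ℝ)) atTop (𝓝 0) →
        ∃ σ : ℕ → ℝ, (∀ n, 0 < σ n) ∧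
          ((fun n : ℕ => σ n ^ 2) =O[atTop] fun n : ℕ => (s n : ℝ) / (n : ℝ)) ∧
          TendstoInDistribution
            (fun (n : ℕ) ω =>
              (dnn x (fun i => (X i ω, Y i ω)) n (s n) - μ x - B (s n)) / σ n)
            atTop (id : ℝ → ℝ) (fun _ => P) (gaussianReal 0 1) := by
  set ν : Measure (EuclideanSpace ℝ (Fin d)) := P.map (X 0) with hνdef
  have : IsProbabilityMeasure ν := Measure.isProbabilityMeasure_map (hX 0).aemeasurable
  obtain ⟨c, C, hc, hcC⟩ := hfbdd
  obtain ⟨U, hU, -, hfU, -⟩ := hfx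
  obtain ⟨U', hU', -, hμU, -⟩ := hμx
  have hfx2 : ContDiffAt ℝ 2 f x := hfU.contDiffAt hU
  have hμx2 : ContDiffAt ℝ 2 μ x := hμU.contDiffAt hU'
  have hν := sphere_null_of_withDensity (x := x) hd hdens
  -- the pairs of features and noises are a function of the observations
  have hpair : Measurable fun q : EuclideanSpace ℝ (Fin d) × ℝ => (q.1, q.2 - μ q.1) :=
    measurable_fst.prodMk (measurable_snd.sub (hμ.comp measurable_fst))
  have hpairs : ∀ i, (fun ω => (X i ω, ε i ω)) =
      (fun q : EuclideanSpace ℝ (Fin d) × ℝ => (q.1, q.2 - μ q.1)) ∘ fun ω => (X i ω, Y i ω) :=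
    fun i => by
      funext ω
      simp [hY]
  have hind : iIndepFun (fun i ω => (X i ω, ε i ω)) P := by
    rw [funext hpairs]
    exact hindep.comp _ fun _ => hpair
  have hid : ∀ i, IdentDistrib (fun ω => (X i ω, ε i ω)) (fun ω => (X 0 ω, ε 0 ω)) P P := by
    intro i
    rw [hpairs i, hpairs 0]
    exact (hident i).comp hpair
  have hlaws : ∀ i, P.map (X i) = ν := fun i => ((hid i).comp measurable_fst).map_eq
  have hidε : ∀ i, IdentDistrib (ε i) (ε 0) P P := fun i => (hid i).comp measurable_snd
  have hindX : iIndepFun X P := hind.comp (fun _ => Prod.fst) fun _ => measurable_fst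
  have hμ2 : MemLp μ 2 ν := by
    rw [hνdef, memLp_map_measure_iff hμ.aestronglyMeasurable (hX 0).aemeasurable]
    refine (hY2.sub hε2).ae_eq (ae_of_all _ fun ω => ?_)
    simp [hY]
  have hv : ∫ ω, ε 0 ω ^ 2 ∂P = variance (ε 0) P := by
    rw [variance_of_integral_eq_zero (hε 0).aemeasurable hε0]
  simp_rw [hY]
  refine ⟨fun s => s * ∫ z, μ z * tailProb ν x z ^ (s - 1) ∂ν - μ x, fun n s hs hsn => ?_,
    bias_sub_isLittleO hd hf hf0 hdens hc (hcC.mono fun z hz => hz.1) hx hfx2 hμx2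
      (hμ2.integrable one_le_two), fun s hs hsn => ?_⟩
  · have hXεseq := indepFun_seq_of_iIndepFun_prodMk hX hε hXε hind
    have hε1 : ∀ i, Integrable (ε i) P := fun i =>
      ((hidε i).memLp_iff.2 hε2).integrable one_le_two
    have h1 : Integrable (fun ω => dnn x (fun i => (X i ω, μ (X i ω))) n s) P :=
      (memLp_dnn hX hlaws hμ2 n s).integrable one_le_two
    have h2 : Integrable (fun ω => ∑ i ∈ Finset.range n,
        nnWeight x (fun k => X k ω) n s i * ε i ω) P :=
      memLp_one_iff_integrable.1 (memLp_sum_mul (ξ := fun ω i => X i ω)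
        (a := fun i p => nnWeight x p n s i) (measurable_pi_lambda _ hX)
        (fun i => memLp_one_iff_integrable.2 (hε1 i)) (fun i => measurable_nnWeight x n s i)
        (fun i p => abs_nnWeight_le_one x p n s i) n)
    simp_rw [dnn_add_noise]
    refine ⟨h1.add h2, ?_⟩
    rw [integral_add h1 h2, integral_dnn hX hindX hlaws hν hμ2 hs hsn,
      integral_sum_mul_eq_zero (ξ := fun ω i => X i ω) (a := fun i p => nnWeight x p n s i)
        (measurable_pi_lambda _ hX) hε hXεseq hε1 (fun i => (hidε i).integral_eq.trans hε0)
        (fun i => measurable_nnWeight x n s i) (fun i p => abs_nnWeight_le_one x p n s i) n]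
    ring
  · obtain ⟨σ, hσ, hσO, hlim⟩ := exists_tendstoInDistribution_dnn hX hε hXε hind hid rfl hν hx hμ
      hμ2 hμx2.continuousAt hε2 hε0 hεvar hv hs hsn
    refine ⟨σ, hσ, hσO, ?_⟩
    convert hlim using 4 with n ω
    ring
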